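/- Let $\mathcal V$ be a finite set of nodes with a directed graph $\mathcal E\subseteq\mathcal V\times\mathcal V$ on it, a source $S\in\mathcal V$ and a destination $D\in\mathcal V$, $D\ne S$, and complex channel gains $h_{ij}$. If the nodes transmit $x=(x_i)_{i\in\mathcal V}\in\mathbb C^{\mathcal V}$, node $j$ receives $$y_j=\sum_{i:\,(i,j)\in\mathcal E}h_{ij}x_i+z_j ,$$ where the noises $z_j$ are i.i.d. $\mathcal{CN}(0,1)$ and independent of the inputs. Let $\Lambda_D=\{\Omega\subseteq\mathcal V: S\in\Omega,\ D\in\Omega^c\}$, and measure information in bits. The cut-set bound is $$\overline C=\sup_{p}\ \min_{\Omega\in\Lambda_D} I(Y_{\Omega^c};X_\Omega\mid X_{\Omega^c}),$$ where $p$ runs over all joint distributions of $(X_j)_{j\in\mathcal V}$ with $\mathbb E|X_j|^2\le 1$ for every $j$. Now let the inputs $X_i$, $i\in\mathcal V$, be i.i.d. $\mathcal{CN}(0,1)$, and quantize each received signal at the noise level (distortion $1$) by the Gaussian quantizer: $$\hat Y_j=\alpha_jY_j+N_j,\qquad \alpha_j=\frac{\sigma_{Y_j}^2-1}{\sigma_{Y_j}^2},\qquad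 N_j\sim\mathcal{CN}\bigl(0,\ (1-\alpha_j^2)\sigma_{Y_j}^2-1\bigr),$$ where $\sigma_{Y_j}^2$ is the variance of $Y_j$ under these inputs, and the $N_j$ are independent of each other, of the inputs and of the channel noises. Then $\overline C$ and $\min_{\Omega\in\Lambda_D} I(\hat Y_{\Omega^c};X_\Omega\mid X_{\Omega^c})$ are finite, and $$\overline C-\min_{\Omega\in\Lambda_D} I(\hat Y_{\Omega^c};X_\Omega\mid X_{\Omega^c})<2|\mathcal V| .$$ -/

import Mathlib

open MeasureTheory ProbabilityTheory
open scoped ENNReal NNReal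

/-- The circularly symmetric complex normal law `CN(0, v)`: real and imaginary parts are independent
real Gaussians of mean `0` and variance `v / 2` each. For `v = 0` it is the point mass at `0`. -/
noncomputable def complexNormal (v : ℝ≥0) : Measure ℂ :=
  ((gaussianReal 0 (v / 2)).prod (gaussianReal 0 (v / 2))).map
    (fun p : ℝ × ℝ => (p.1 : ℂ) + (p.2 : ℂ) * Complex.I)

instance complexNormal_isProbabilityMeasure (v : ℝ≥0) :
    IsProbabilityMeasure (complexNormal v) := by
  unfold complexNormal
  exact Measure.isProbabilityMeasure_map (by fun_prop)

/-- Conditional mutual information `I(A; B | C)`, in bits: the Kullback-Leibler divergence of the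
joint law of `(C, A, B)` from `P_C ⊗ (P_{A|C} × P_{B|C})`. -/
noncomputable def condMutualInfo {T α β γ : Type*} [MeasurableSpace T]
    [MeasurableSpace α] [StandardBorelSpace α] [Nonempty α]
    [MeasurableSpace β] [StandardBorelSpace β] [Nonempty β] [MeasurableSpace γ]
    (A : T → α) (B : T → β) (C : T → γ) (μ : Measure T) [IsFiniteMeasure μ] : ℝ≥0∞ :=
  InformationTheory.klDiv (μ.map (fun t => (C t, (A t, B t))))
      (Measure.compProd (μ.map C) (Kernel.prod (condDistrib A C μ) (condDistrib B C μ)))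
    / ENNReal.ofReal (Real.log 2)

/-- A Gaussian relay network with node set `V`: a directed graph, a source, a destination distinct
from it, and complex channel gains; `gain i j` is the gain from `i` to `j` (it matters only when
there is an edge from `i` to `j`). -/
structure GaussianRelayNetwork (V : Type*) where
  graph : Digraph V
  source : V
  dest : V
  source_ne_dest : source ≠ dest
  gain : V → V → ℂ

namespace GaussianRelayNetwork

variable {V : Type*} (G : GaussianRelayNetwork V)

/-- The source-destination cuts `Ω` : `S ∈ Ω` and `D ∈ Ωᶜ`. -/
def cuts : Set (Set V) := {Ω | G.source ∈ Ω ∧ G.dest ∈ Ωᶜ}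

variable [Fintype V]

open Classical in
/-- The signal received at `j` when `x` is transmitted and the noise is `z`. -/
noncomputable def received (x z : V → ℂ) (j : V) : ℂ :=
  (∑ i with G.graph.Adj i j, G.gain i j * x i) + z j

/-- The joint law of inputs and channel noise: the inputs have law `p`, the noises are i.i.d.
`CN(0, 1)` and independent of the inputs. -/
noncomputable def channelLaw (p : Measure (V → ℂ)) : Measure ((V → ℂ) × (V → ℂ)) :=
  p.prod (Measure.pi fun _ : V => complexNormal 1)

instance channelLaw_isProbabilityMeasure (p : Measure (V → ℂ)) [IsProbabilityMeasure p] :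
    IsProbabilityMeasure (channelLaw p) := by
  unfold channelLaw
  infer_instance

/-- `I(Y_{Ωᶜ}; X_Ω | X_{Ωᶜ})` when the inputs have joint law `p`. -/
noncomputable def cutInfo (p : Measure (V → ℂ)) [IsProbabilityMeasure p] (Ω : Set V) : ℝ≥0∞ :=
  condMutualInfo (fun ω (j : ↥Ωᶜ) => G.received ω.1 ω.2 j) (fun ω (i : ↥Ω) => ω.1 i)
    (fun ω (i : ↥Ωᶜ) => ω.1 i) (channelLaw p)

/-- The average power constraint `E|x_j|² ≤ 1` at every node. -/
def PowerConstraint (p : Measure (V → ℂ)) : Prop :=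
  ∀ j : V, ∫⁻ x, ‖x j‖ₑ ^ 2 ∂p ≤ 1

/-- The cut-set bound: the supremum, over all joint laws of the inputs that meet the power
constraint, of the minimum over all cuts of `I(Y_{Ωᶜ}; X_Ω | X_{Ωᶜ})`. -/
noncomputable def cutSetBound : ℝ≥0∞ :=
  ⨆ (p : ProbabilityMeasure (V → ℂ)) (_ : PowerConstraint (p : Measure (V → ℂ))),
    ⨅ Ω ∈ G.cuts, G.cutInfo (p : Measure (V → ℂ)) Ω

/-- I.i.d. `CN(0, 1)` inputs. -/
noncomputable def iidInput (V : Type*) [Fintype V] : Measure (V → ℂ) :=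
  Measure.pi fun _ : V => complexNormal 1

instance iidInput_isProbabilityMeasure : IsProbabilityMeasure (iidInput V) := by
  unfold iidInput
  infer_instance

/-- The variance `σ²_Y = E|Y_j|²` of the (centred) received signal at `j` under i.i.d. `CN(0, 1)`
inputs. -/
noncomputable def receivedVariance (j : V) : ℝ :=
  ∫ ω, ‖G.received ω.1 ω.2 j‖ ^ 2 ∂(channelLaw (iidInput V))

/-- The coefficient `α = (σ²_Y - 1) / σ²_Y` of the Gaussian quantizer of distortion `1` at `j`. -/
noncomputable def quantCoeff (j : V) : ℝ :=
  (G.receivedVariance j - 1) / G.receivedVariance j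

/-- The variance `σ²_N = (1 - α²) σ²_Y - 1` of the quantization noise at `j`. -/
noncomputable def quantNoiseVar (j : V) : ℝ≥0 :=
  ((1 - G.quantCoeff j ^ 2) * G.receivedVariance j - 1).toNNReal

/-- The joint law of inputs, channel noises and quantization noises: the inputs are i.i.d.
`CN(0, 1)`, and the quantization noises are independent of each other and of everything else. -/
noncomputable def quantizedLaw : Measure (((V → ℂ) × (V → ℂ)) × (V → ℂ)) :=
  (channelLaw (iidInput V)).prod (Measure.pi fun j => complexNormal (G.quantNoiseVar j))

instance quantizedLaw_isProbabilityMeasure : IsProbabilityMeasure G.quantizedLaw := by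
  unfold quantizedLaw
  infer_instance

/-- The quantized received signal `Ŷ_j = α_j Y_j + N_j`. -/
noncomputable def quantized (x z n : V → ℂ) (j : V) : ℂ :=
  (G.quantCoeff j : ℂ) * G.received x z j + n j

/-- `I(Ŷ_{Ωᶜ}; X_Ω | X_{Ωᶜ})` for i.i.d. `CN(0, 1)` inputs. -/
noncomputable def quantizedCutInfo (Ω : Set V) : ℝ≥0∞ :=
  condMutualInfo (fun ω (j : ↥Ωᶜ) => G.quantized ω.1.1 ω.1.2 ω.2 j)
    (fun ω (i : ↥Ω) => ω.1.1 i) (fun ω (i : ↥Ωᶜ) => ω.1.1 i) G.quantizedLaw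

/-- The minimum over all cuts of `I(Ŷ_{Ωᶜ}; X_Ω | X_{Ωᶜ})` for i.i.d. `CN(0, 1)` inputs. -/
noncomputable def quantizedMinCut : ℝ≥0∞ :=
  ⨅ Ω ∈ G.cuts, G.quantizedCutInfo Ω

end GaussianRelayNetwork

/-!
The bound is proved with `|V|` nats in place of `2 |V|` bits, and `1 / log 2 < 2`. Fix a cut `Ω`
with transfer matrix `H` from `Ω` to `Ωᶜ`, let `γ` be the law of i.i.d. `CN(0, 1)` inputs on `Ω`,
and let `J = ∫ exp (-‖H η‖²) dγ(η)`, so that `-log J` is `log det (1 + H Hᴴ)`; the determinant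
itself is never needed. Both sides are compared with `-log J`.

*Upper bound* (`cutInfo_le`): for all inputs of power at most one, the cut information is at most
`|Ω| - log J` nats. By the chain rule, the conditional mutual information is at most the
divergence from any product `P_C ⊗ (Q × P_{B|C})` (`condMutualInfo_le_klDiv`). Take for `Q` the
output law under `γ`, translated by the contribution of the inputs in `Ωᶜ`. Translating the
variable of `γ` by `x` (Cameron-Martin) and discarding the odd part of the exponent by symmetry
shows that the output law given the input `x` is at most `exp (‖x‖²) / J` times the output law
under `γ` (`gaussianLaplace_mul_map_add_le`). The logarithm of this factor has mean at most
`|Ω| - log J`.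

*Lower bound* (`le_quantizedCutInfo`): the quantized information is at least `-log J - |Ωᶜ|` nats.
By the Donsker-Varadhan inequality it is at least the mean of `log r`, for any conditional density
`r` relative to `γ` of the input given the output. Take for `r` the Gaussian density with
precision `1 + Hᴴ H`, whose normalization is again `J`, centred at the linear estimate of the
input from the quantized output. What remains is to bound the mean of `‖e‖² + ‖H e‖²`, where `e`
is the estimation error, by `|Ω| + |Ωᶜ|`. Given the input, the quantizer has noise variance
`α² + α` and gain `α`, with `α = g / (g + 1)` and `g` the energy of the gains into the node. So
after whitening, the row `j` of `H` is scaled by `√d`, `d = g / (2 g + 1)`, and each receiver adds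
at most `1` to the trace (`exists_linear_estimator`).

A node without incoming gain has `α = 0`, and its quantized signal is the constant `0`. The noise
variance `0` is allowed throughout; quotients by it are then `0` by convention, which is the
correct value since the signal vanishes as well.
-/

/-! ### Relative entropy and conditional mutual information -/

/-- If `P` is dominated by `exp φ` times `ν`, then the divergence of `P` from `ν` is at most the
mean of `φ` under `P`. -/
theorem klDiv_le_of_le_withDensity {α : Type*} [MeasurableSpace α] {P ν : Measure α}
    [IsProbabilityMeasure P] [IsProbabilityMeasure ν] {φ : α → ℝ}
    (hint : Integrable φ P)
    (hle : P ≤ ν.withDensity (fun x => ENNReal.ofReal (Real.exp (φ x)))) :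
    InformationTheory.klDiv P ν ≤ ENNReal.ofReal (∫ x, φ x ∂P) := by
  have hac : P ≪ ν :=
    (Measure.absolutelyContinuous_of_le hle).trans (withDensity_absolutelyContinuous _ _)
  have hrn : ∀ᵐ x ∂ν, P.rnDeriv ν x ≤ ENNReal.ofReal (Real.exp (φ x)) := by
    refine ae_le_of_forall_setLIntegral_le_of_sigmaFinite (Measure.measurable_rnDeriv _ _) ?_
    intro s hs _
    calc ∫⁻ x in s, P.rnDeriv ν x ∂ν ≤ P s := Measure.setLIntegral_rnDeriv_le s
      _ ≤ _ := hle s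
      _ = _ := withDensity_apply _ hs
  have hI1 : Integrable (fun x => (P.rnDeriv ν x).toReal * φ x) ν := by
    simpa [smul_eq_mul] using (integrable_rnDeriv_smul_iff hac).2 hint
  have hI2 : Integrable (fun x => (P.rnDeriv ν x).toReal) ν := Measure.integrable_toReal_rnDeriv
  have hI3 : Integrable (fun x => (P.rnDeriv ν x).toReal * φ x + 1) ν :=
    hI1.add (integrable_const 1)
  have hI : Integrable (fun x => (P.rnDeriv ν x).toReal * φ x + 1 - (P.rnDeriv ν x).toReal) ν :=
    hI3.sub hI2
  -- `klFun t = t log t + 1 - t`, and `log t ≤ φ` where `t` is the density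
  have hpt : ∀ᵐ x ∂ν, InformationTheory.klFun (P.rnDeriv ν x).toReal ≤
      (P.rnDeriv ν x).toReal * φ x + 1 - (P.rnDeriv ν x).toReal := by
    filter_upwards [hrn] with x hx
    rw [InformationTheory.klFun_apply]
    have h0 : 0 ≤ (P.rnDeriv ν x).toReal := ENNReal.toReal_nonneg
    have h1 : (P.rnDeriv ν x).toReal ≤ Real.exp (φ x) :=
      ENNReal.toReal_le_of_le_ofReal (Real.exp_pos _).le hx
    have h2 : (P.rnDeriv ν x).toReal * Real.log (P.rnDeriv ν x).toReal ≤
        (P.rnDeriv ν x).toReal * φ x := by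
      rcases h0.eq_or_lt with h | h
      · simp [← h]
      · exact mul_le_mul_of_nonneg_left ((Real.log_le_iff_le_exp h).2 h1) h0
    linarith
  have hval : ∫ x, ((P.rnDeriv ν x).toReal * φ x + 1 - (P.rnDeriv ν x).toReal) ∂ν
      = ∫ x, φ x ∂P := by
    rw [integral_sub hI3 hI2, integral_add hI1 (integrable_const 1),
      integral_toReal_rnDeriv_mul hac, Measure.integral_toReal_rnDeriv hac]
    simp
  rw [InformationTheory.klDiv_eq_lintegral_klFun_of_ac hac, ← hval,
    ofReal_integral_eq_lintegral_ofReal hI]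
  · refine lintegral_mono_ae ?_
    filter_upwards [hpt] with x hx using ENNReal.ofReal_le_ofReal hx
  · filter_upwards [hpt] with x hx
    exact (InformationTheory.klFun_nonneg ENNReal.toReal_nonneg).trans hx

/-- The Donsker-Varadhan lower bound on the divergence, for a test function with `∫ exp φ dM ≤ 1`.
-/
theorem ofReal_integral_le_klDiv {α : Type*} [MeasurableSpace α] {P M : Measure α}
    [IsProbabilityMeasure P] [IsProbabilityMeasure M] {φ : α → ℝ} (hφ : Measurable φ)
    (hint : Integrable φ P) (hle : ∫⁻ x, ENNReal.ofReal (Real.exp (φ x)) ∂M ≤ 1) :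
    ENNReal.ofReal (∫ x, φ x ∂P) ≤ InformationTheory.klDiv P M := by
  by_cases hac : P ≪ M
  swap
  · rw [InformationTheory.klDiv_of_not_ac hac]; exact le_top
  by_cases hllr : Integrable (llr P M) P
  swap
  · rw [InformationTheory.klDiv_of_not_integrable hllr]; exact le_top
  rw [InformationTheory.klDiv_of_ac_of_integrable hac hllr]
  refine ENNReal.ofReal_le_ofReal ?_
  simp only [probReal_univ, add_sub_cancel_right]
  have hmeas : Measurable fun x => Real.exp (φ x - llr P M x) :=
    (hφ.sub (measurable_llr P M)).exp
  have hlin : ∫⁻ x, ENNReal.ofReal (Real.exp (φ x - llr P M x)) ∂P ≤ 1 := by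
    rw [← lintegral_rnDeriv_mul hac hmeas.ennreal_ofReal.aemeasurable]
    refine (lintegral_mono_ae ?_).trans hle
    filter_upwards [P.rnDeriv_ne_top M] with x hx
    by_cases h0 : P.rnDeriv M x = 0
    · simp [h0]
    · have hpos : 0 < (P.rnDeriv M x).toReal := ENNReal.toReal_pos h0 hx
      rw [Real.exp_sub, llr, Real.exp_log hpos, ENNReal.ofReal_div_of_pos hpos,
        ENNReal.ofReal_toReal hx, ENNReal.mul_div_cancel h0 hx]
  have hexp : Integrable (fun x => Real.exp (φ x - llr P M x)) P := by
    refine ⟨hmeas.aestronglyMeasurable, ?_⟩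
    rw [hasFiniteIntegral_iff_ofReal (ae_of_all _ fun x => (Real.exp_pos _).le)]
    exact hlin.trans_lt ENNReal.one_lt_top
  have hexp1 : ∫ x, Real.exp (φ x - llr P M x) ∂P ≤ 1 := by
    rw [integral_eq_lintegral_of_nonneg_ae (ae_of_all _ fun x => (Real.exp_pos _).le)
      hmeas.aestronglyMeasurable]
    exact ENNReal.toReal_mono ENNReal.one_ne_top hlin
  -- integrate `1 + t ≤ exp t` at `t = φ - llr P M`
  have hmono : ∫ x, (φ x - llr P M x + 1) ∂P ≤ ∫ x, Real.exp (φ x - llr P M x) ∂P :=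
    integral_mono ((hint.sub hllr).add (integrable_const 1)) hexp
      fun x => Real.add_one_le_exp _
  have hsplit : ∫ x, (φ x - llr P M x + 1) ∂P = ∫ x, φ x ∂P - ∫ x, llr P M x ∂P + 1 := by
    have hsub : Integrable (fun x => φ x - llr P M x) P := hint.sub hllr
    rw [integral_add hsub (integrable_const 1), integral_sub hint hllr]
    simp
  linarith

theorem klDiv_map_measurableEquiv {α β : Type*} [MeasurableSpace α] [MeasurableSpace β]
    (P M : Measure α) [IsFiniteMeasure P] [IsFiniteMeasure M] (e : α ≃ᵐ β) :
    InformationTheory.klDiv (P.map e) (M.map e) = InformationTheory.klDiv P M := by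
  refine le_antisymm (InformationTheory.klDiv_map_le _ _ e.measurable) ?_
  have h := InformationTheory.klDiv_map_le (P.map e) (M.map e) e.symm.measurable
  rwa [Measure.map_map e.symm.measurable e.measurable, Measure.map_map e.symm.measurable
    e.measurable, e.symm_comp_self, Measure.map_id, Measure.map_id] at h

theorem compProd_prod_map_prodAssoc_symm {α β γ : Type*} [MeasurableSpace α]
    [MeasurableSpace β] [MeasurableSpace γ] (π : Measure γ) [SFinite π] (κ : Kernel γ α)
    (η : Kernel γ β) [IsMarkovKernel κ] [IsMarkovKernel η] :
    (π ⊗ₘ (κ ×ₖ η)).map MeasurableEquiv.prodAssoc.symm = (π ⊗ₘ κ) ⊗ₘ (η.prodMkRight α) := by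
  ext s hs
  rw [Measure.map_apply MeasurableEquiv.prodAssoc.symm.measurable hs,
    Measure.compProd_apply (MeasurableEquiv.prodAssoc.symm.measurable hs),
    Measure.compProd_apply hs, Measure.lintegral_compProd]
  · refine lintegral_congr fun c => ?_
    rw [Kernel.prod_apply, Measure.prod_apply]
    · rfl
    · exact measurable_prodMk_left (MeasurableEquiv.prodAssoc.symm.measurable hs)
  · exact Kernel.measurable_kernel_prodMk_left hs

section CondMutualInfo

variable {T α β γ : Type*} [MeasurableSpace T]
  [MeasurableSpace α] [StandardBorelSpace α] [Nonempty α]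
  [MeasurableSpace β] [StandardBorelSpace β] [Nonempty β] [MeasurableSpace γ]
  {A : T → α} {B : T → β} {C : T → γ} {μ : Measure T} [IsProbabilityMeasure μ]

/-- Replacing the conditional law of `A` given `C` by an arbitrary kernel can only increase the
divergence that defines `I(A; B | C)`: both divergences satisfy the chain rule along `(C, A)` then
`B`, with the same second term, and the first term vanishes for the true conditional law. -/
theorem condMutualInfo_le_klDiv (hA : Measurable A) (hB : Measurable B) (hC : Measurable C)
    (Q : Kernel γ α) [IsMarkovKernel Q] :
    condMutualInfo A B C μ ≤ InformationTheory.klDiv (μ.map (fun t => (C t, (A t, B t))))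
      (μ.map C ⊗ₘ (Q ×ₖ condDistrib B C μ)) / ENNReal.ofReal (Real.log 2) := by
  unfold condMutualInfo
  refine ENNReal.div_le_div_right ?_ _
  have : IsProbabilityMeasure (μ.map C) := Measure.isProbabilityMeasure_map hC.aemeasurable
  have : IsProbabilityMeasure (μ.map fun t => (C t, (A t, B t))) :=
    Measure.isProbabilityMeasure_map (by fun_prop)
  have : IsProbabilityMeasure (μ.map fun t => (C t, A t)) :=
    Measure.isProbabilityMeasure_map (by fun_prop)
  rw [← klDiv_map_measurableEquiv _ _ MeasurableEquiv.prodAssoc.symm,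
    ← klDiv_map_measurableEquiv _ (μ.map C ⊗ₘ (Q ×ₖ condDistrib B C μ))
      MeasurableEquiv.prodAssoc.symm, compProd_prod_map_prodAssoc_symm,
    compProd_prod_map_prodAssoc_symm, compProd_map_condDistrib hA.aemeasurable]
  have hP : (μ.map fun t => (C t, (A t, B t))).map MeasurableEquiv.prodAssoc.symm
      = (μ.map fun t => (C t, A t)) ⊗ₘ condDistrib B (fun t => (C t, A t)) μ := by
    rw [compProd_map_condDistrib hB.aemeasurable,
      Measure.map_map MeasurableEquiv.prodAssoc.symm.measurable (by fun_prop)]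
    rfl
  rw [hP, InformationTheory.klDiv_compProd_eq_add (ν := μ.map C ⊗ₘ Q)]
  exact le_add_self

end CondMutualInfo

/-! ### The complex normal law -/

/-- Cameron-Martin formula in one real dimension. The degenerate variance `0` is allowed if there
is no translation. -/
theorem gaussianReal_map_add_const_eq_withDensity {v : ℝ≥0} {u : ℝ} (h : v = 0 → u = 0) :
    (gaussianReal 0 v).map (· + u) = (gaussianReal 0 v).withDensity
      fun y => ENNReal.ofReal (Real.exp ((2 * (u * y) - u ^ 2) / (2 * v))) := by
  rcases eq_or_ne v 0 with rfl | hv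
  · simp [h rfl]
  · rw [gaussianReal_map_add_const, zero_add, gaussianReal_of_var_ne_zero _ hv,
      gaussianReal_of_var_ne_zero _ hv, ← withDensity_mul _ (measurable_gaussianPDF _ _)
      (by fun_prop)]
    congr 1
    ext y
    have hv' : (v : ℝ) ≠ 0 := by exact_mod_cast hv
    simp only [Pi.mul_apply, gaussianPDF, gaussianPDFReal]
    rw [← ENNReal.ofReal_mul (by positivity), mul_assoc (√_)⁻¹, ← Real.exp_add]
    congr 3
    field_simp
    ring

theorem map_withDensity_comp {α β : Type*} [MeasurableSpace α] [MeasurableSpace β]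
    (μ : Measure α) {g : α → β} (hg : Measurable g) {f : β → ℝ≥0∞} (hf : Measurable f) :
    (μ.withDensity (f ∘ g)).map g = (μ.map g).withDensity f := by
  ext s hs
  rw [Measure.map_apply hg hs, withDensity_apply _ (hg hs), withDensity_apply _ hs,
    setLIntegral_map hs hf hg]
  rfl

theorem complexNormal_map_add_const_eq_withDensity {v : ℝ≥0} {u : ℂ} (h : v = 0 → u = 0) :
    (complexNormal v).map (· + u) = (complexNormal v).withDensity
      fun y => ENNReal.ofReal
        (Real.exp ((2 * (starRingEnd ℂ u * y).re - ‖u‖ ^ 2) / v)) := by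
  have hre : v / 2 = 0 → u.re = 0 := fun hv => by
    have : v = 0 := by simpa using hv
    simp [h this]
  have him : v / 2 = 0 → u.im = 0 := fun hv => by
    have : v = 0 := by simpa using hv
    simp [h this]
  have h1 := congrArg₂ Measure.prod (gaussianReal_map_add_const_eq_withDensity hre)
    (gaussianReal_map_add_const_eq_withDensity him)
  rw [Measure.map_prod_map _ _ (by fun_prop) (by fun_prop),
    prod_withDensity (by fun_prop) (by fun_prop)] at h1
  unfold complexNormal
  rw [Measure.map_map (by fun_prop) (by fun_prop), ← map_withDensity_comp _ (by fun_prop)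
    (by fun_prop)]
  have h2 := congrArg (Measure.map fun p : ℝ × ℝ => (p.1 : ℂ) + (p.2 : ℂ) * Complex.I) h1
  rw [Measure.map_map (by fun_prop) (by fun_prop)] at h2
  refine Eq.trans ?_ (h2.trans ?_)
  · congr 1
    ext p
    apply Complex.ext <;> simp
  · congr 2
    ext p
    simp only [Function.comp_apply]
    rw [← ENNReal.ofReal_mul (by positivity), ← Real.exp_add]
    congr 2
    rw [← Complex.normSq_eq_norm_sq, Complex.normSq_apply]
    push_cast
    rcases eq_or_ne (v : ℝ) 0 with h0 | h0
    · simp [h0]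
    simp
    field_simp
    ring

/-- A product of measures with densities has the product of the densities as its density. -/
theorem pi_withDensity {ι : Type*} [Fintype ι] {E : ι → Type*} [∀ i, MeasurableSpace (E i)]
    (μ : ∀ i, Measure (E i)) [∀ i, IsProbabilityMeasure (μ i)] {f : ∀ i, E i → ℝ≥0∞}
    (hf : ∀ i, Measurable (f i)) [∀ i, SigmaFinite ((μ i).withDensity (f i))] :
    Measure.pi (fun i => (μ i).withDensity (f i)) =
      (Measure.pi μ).withDensity fun x => ∏ i, f i (x i) := by
  refine Measure.pi_eq fun s hs => ?_
  rw [withDensity_apply _ (MeasurableSet.univ_pi hs),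
    ← lintegral_indicator (MeasurableSet.univ_pi hs)]
  have hind : ∀ x : ∀ i, E i, (Set.univ.pi s).indicator (fun x => ∏ i, f i (x i)) x
      = ∏ i, (s i).indicator (f i) (x i) := by
    intro x
    by_cases hx : x ∈ Set.univ.pi s
    · rw [Set.indicator_of_mem hx]
      exact Finset.prod_congr rfl fun i _ => by rw [Set.indicator_of_mem (hx i trivial)]
    · rw [Set.indicator_of_notMem hx]
      obtain ⟨i, hi⟩ : ∃ i, x i ∉ s i := by simpa [Set.mem_pi] using hx
      rw [Finset.prod_eq_zero (Finset.mem_univ i)]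
      rw [Set.indicator_of_notMem hi]
  simp_rw [hind]
  have hm : ∀ i, Measurable ((s i).indicator (f i)) := fun i => (hf i).indicator (hs i)
  rw [lintegral_prod_eq_prod_lintegral_of_indepFun Finset.univ
    (fun i (x : ∀ i, E i) => (s i).indicator (f i) (x i))
    (iIndepFun_pi fun i => (hm i).aemeasurable) fun i => (hm i).comp (measurable_pi_apply i)]
  refine Finset.prod_congr rfl fun i _ => ?_
  rw [withDensity_apply _ (hs i), ← lintegral_indicator (hs i),
    (measurePreserving_eval μ i).lintegral_comp (hm i)]

/-- Cameron-Martin formula for independent complex normal variables, where a coordinate of variance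
`0` is not translated. -/
theorem pi_complexNormal_map_add_const_eq_withDensity {ι : Type*} [Fintype ι] {v : ι → ℝ≥0}
    {u : ι → ℂ} (h : ∀ j, v j = 0 → u j = 0) :
    (Measure.pi fun j => complexNormal (v j)).map (· + u) =
      (Measure.pi fun j => complexNormal (v j)).withDensity fun y => ENNReal.ofReal
        (Real.exp (∑ j, (2 * (starRingEnd ℂ (u j) * y j).re - ‖u j‖ ^ 2) / v j)) := by
  have hj := fun j => complexNormal_map_add_const_eq_withDensity (h j)
  have hp : ∀ j, IsProbabilityMeasure ((complexNormal (v j)).map (· + u j)) := fun j =>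
    Measure.isProbabilityMeasure_map (by fun_prop)
  have hp' := hp
  simp_rw [hj] at hp'
  have h1 : (Measure.pi fun j => complexNormal (v j)).map (· + u) =
      Measure.pi fun j => (complexNormal (v j)).map (· + u j) :=
    Measure.pi_map_pi (f := fun j y => y + u j) fun j => by fun_prop
  simp_rw [h1, hj]
  rw [pi_withDensity _ fun j => by fun_prop]
  congr 1
  ext y
  rw [Real.exp_sum, ENNReal.ofReal_prod_of_nonneg fun _ _ => (Real.exp_pos _).le]

theorem complexNormal_map_neg (v : ℝ≥0) :
    (complexNormal v).map (fun z => -z) = complexNormal v := by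
  have h := Measure.map_prod_map (gaussianReal 0 (v / 2)) (gaussianReal 0 (v / 2))
    measurable_neg measurable_neg
  have hn : (gaussianReal 0 (v / 2)).map Neg.neg = gaussianReal 0 (v / 2) := by
    simpa using gaussianReal_map_neg (μ := 0) (v := v / 2)
  rw [hn] at h
  unfold complexNormal
  conv_rhs => rw [h]
  rw [Measure.map_map (by fun_prop) (by fun_prop), Measure.map_map (by fun_prop) (by fun_prop)]
  congr 1
  ext p
  simp
  ring

theorem pi_complexNormal_map_neg {ι : Type*} [Fintype ι] (v : ι → ℝ≥0) :
    (Measure.pi fun j => complexNormal (v j)).map (fun z => -z) =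
      Measure.pi fun j => complexNormal (v j) := by
  have hp : ∀ j, IsProbabilityMeasure ((complexNormal (v j)).map (fun z => -z)) := fun j =>
    Measure.isProbabilityMeasure_map (by fun_prop)
  have h := Measure.pi_map_pi (μ := fun j => complexNormal (v j)) (f := fun _ z => -z)
    fun j => by fun_prop
  simp_rw [complexNormal_map_neg] at h
  exact h

theorem memLp_id_complexNormal (v : ℝ≥0) : MemLp id 2 (complexNormal v) := by
  unfold complexNormal
  rw [memLp_map_measure_iff (by fun_prop) (by fun_prop)]
  have h1 : MemLp (fun p : ℝ × ℝ => (p.1 : ℂ)) 2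
      ((gaussianReal 0 (v / 2)).prod (gaussianReal 0 (v / 2))) :=
    ((memLp_id_gaussianReal 2).comp_measurePreserving measurePreserving_fst).ofReal
  have h2 : MemLp (fun p : ℝ × ℝ => (p.2 : ℂ)) 2
      ((gaussianReal 0 (v / 2)).prod (gaussianReal 0 (v / 2))) :=
    ((memLp_id_gaussianReal 2).comp_measurePreserving measurePreserving_snd).ofReal
  exact h1.add (h2.mul_const Complex.I)

theorem integral_id_complexNormal (v : ℝ≥0) : ∫ z, z ∂complexNormal v = 0 := by
  have h : ∫ z, z ∂complexNormal v = -∫ z, z ∂complexNormal v := by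
    conv_lhs => rw [← complexNormal_map_neg v]
    rw [integral_map (by fun_prop) (by fun_prop), integral_neg]
  exact self_eq_neg.1 h

theorem integral_norm_sq_complexNormal (v : ℝ≥0) : ∫ z, ‖z‖ ^ 2 ∂complexNormal v = v := by
  have hsq : ∫ x, x ^ 2 ∂gaussianReal 0 (v / 2) = v / 2 := by
    have h := variance_fun_id_gaussianReal (μ := 0) (v := v / 2)
    rw [variance_of_integral_eq_zero (by fun_prop) (by simp)] at h
    simpa using h
  have hint : Integrable (fun x : ℝ => x ^ 2) (gaussianReal 0 (v / 2)) :=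
    (memLp_id_gaussianReal 2).integrable_sq
  unfold complexNormal
  rw [integral_map (by fun_prop) (by fun_prop)]
  have : ∀ p : ℝ × ℝ, ‖(p.1 : ℂ) + (p.2 : ℂ) * Complex.I‖ ^ 2 = p.1 ^ 2 + p.2 ^ 2 := by
    intro p
    rw [← Complex.normSq_eq_norm_sq, Complex.normSq_add_mul_I]
  simp_rw [this]
  rw [integral_add (hint.comp_fst _) (hint.comp_snd _)]
  rw [integral_fun_fst (fun x : ℝ => x ^ 2), integral_fun_snd (fun x : ℝ => x ^ 2), hsq]
  simp

theorem gaussianReal_prod_map_mul_add (a : ℝ) (v w : ℝ≥0) :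
    ((gaussianReal 0 v).prod (gaussianReal 0 w)).map (fun p => a * p.1 + p.2) =
      gaussianReal 0 ((a ^ 2).toNNReal * v + w) := by
  have h := gaussianReal_conv_gaussianReal (m₁ := a * 0) (m₂ := 0)
    (v₁ := .mk (a ^ 2) (sq_nonneg a) * v) (v₂ := w)
  rw [← gaussianReal_map_const_mul, Measure.conv, ← Measure.map_id (μ := gaussianReal 0 w),
    Measure.map_prod_map _ _ (by fun_prop) (by fun_prop),
    Measure.map_map (by fun_prop) (by fun_prop)] at h
  rw [Real.toNNReal_of_nonneg (sq_nonneg a)]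
  simpa using! h

/-- The sum of a real multiple of a complex normal variable and an independent one is complex
normal. -/
theorem complexNormal_prod_map_mul_add (a : ℝ) (v w : ℝ≥0) :
    ((complexNormal v).prod (complexNormal w)).map (fun p => (a : ℂ) * p.1 + p.2) =
      complexNormal ((a ^ 2).toNNReal * v + w) := by
  have hvar : ((a ^ 2).toNNReal * v + w) / 2 = (a ^ 2).toNNReal * (v / 2) + w / 2 := by
    rw [add_div, mul_div_assoc]
  refine Measure.ext_of_lintegral _ fun f hf => ?_
  have hG := gaussianReal_prod_map_mul_add a (v / 2) (w / 2)
  unfold complexNormal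
  rw [hvar, ← hG, lintegral_map hf (by fun_prop), Measure.map_prod_map _ _ (by fun_prop)
    (by fun_prop), lintegral_map (by fun_prop) (by fun_prop), lintegral_map hf (by fun_prop),
    Measure.map_prod_map _ _ (by fun_prop) (by fun_prop),
    lintegral_map (by fun_prop) (by fun_prop),
    lintegral_prod _ (by fun_prop), lintegral_prod _ (by fun_prop),
    lintegral_prod _ (by fun_prop), lintegral_prod _ (by fun_prop)]
  refine lintegral_congr fun x => ?_
  simp only [Prod.map_apply]
  have hf1 : ∀ y : ℝ, ∫⁻ q : ℝ × ℝ, f (a * (x + y * Complex.I) + (q.1 + q.2 * Complex.I))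
      ∂(gaussianReal 0 (w / 2)).prod (gaussianReal 0 (w / 2)) =
      ∫⁻ x', ∫⁻ y', f (a * (x + y * Complex.I) + (x' + y' * Complex.I))
        ∂gaussianReal 0 (w / 2) ∂gaussianReal 0 (w / 2) := fun y =>
    lintegral_prod _ (by fun_prop)
  have hf2 : ∀ x' : ℝ, ∫⁻ q : ℝ × ℝ, f (((a * x + x' : ℝ) : ℂ)
        + ((a * q.1 + q.2 : ℝ) : ℂ) * Complex.I)
      ∂(gaussianReal 0 (v / 2)).prod (gaussianReal 0 (w / 2)) =
      ∫⁻ y, ∫⁻ y', f (((a * x + x' : ℝ) : ℂ) + ((a * y + y' : ℝ) : ℂ) * Complex.I)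
        ∂gaussianReal 0 (w / 2) ∂gaussianReal 0 (v / 2) := fun x' =>
    lintegral_prod _ (by fun_prop)
  simp_rw [hf1, hf2]
  rw [lintegral_lintegral_swap]
  · refine lintegral_congr fun x' => lintegral_congr fun y => lintegral_congr fun y' => ?_
    congr 1
    push_cast
    ring
  · exact Measurable.aemeasurable (Measurable.lintegral_prod_right (by fun_prop))

/-! ### Second moments -/

section SecondMoments

variable {ι : Type*} [Fintype ι]

theorem memLp_eval_pi_complexNormal (v : ι → ℝ≥0) (j : ι) :
    MemLp (fun z : ι → ℂ => z j) 2 (Measure.pi fun j => complexNormal (v j)) :=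
  (memLp_id_complexNormal (v j)).comp_measurePreserving
    (measurePreserving_eval (fun j => complexNormal (v j)) j)

theorem memLp_sum_mul_pi_complexNormal (v : ι → ℝ≥0) (c : ι → ℂ) :
    MemLp (fun z : ι → ℂ => ∑ j, c j * z j) 2 (Measure.pi fun j => complexNormal (v j)) :=
  memLp_finsetSum _ fun j _ => (memLp_eval_pi_complexNormal v j).const_mul (c j)

theorem integral_eval_pi_complexNormal (v : ι → ℝ≥0) (j : ι) :
    ∫ z : ι → ℂ, z j ∂(Measure.pi fun j => complexNormal (v j)) = 0 := by
  rw [integral_comp_eval (μ := fun j => complexNormal (v j)) (f := fun z : ℂ => z) (by fun_prop),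
    integral_id_complexNormal]

theorem integral_sum_mul_pi_complexNormal (v : ι → ℝ≥0) (c : ι → ℂ) :
    ∫ z : ι → ℂ, ∑ j, c j * z j ∂(Measure.pi fun j => complexNormal (v j)) = 0 := by
  rw [integral_finsetSum _ fun j _ =>
    ((memLp_eval_pi_complexNormal v j).integrable one_le_two).const_mul (c j)]
  refine Finset.sum_eq_zero fun j _ => ?_
  rw [integral_const_mul, integral_eval_pi_complexNormal, mul_zero]

theorem integral_eval_mul_conj_eval_pi_complexNormal [DecidableEq ι] (v : ι → ℝ≥0) (j k : ι) :
    ∫ z : ι → ℂ, z j * starRingEnd ℂ (z k) ∂(Measure.pi fun j => complexNormal (v j)) =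
      if j = k then (v j : ℂ) else 0 := by
  split_ifs with h
  · subst h
    rw [integral_comp_eval (μ := fun j => complexNormal (v j))
      (f := fun z : ℂ => z * starRingEnd ℂ z) (by fun_prop)]
    simp_rw [Complex.mul_conj, Complex.normSq_eq_norm_sq]
    rw [integral_complex_ofReal, integral_norm_sq_complexNormal]
  · have hind : iIndepFun (fun i (z : ι → ℂ) => z i) (Measure.pi fun j => complexNormal (v j)) :=
      iIndepFun_pi (X := fun _ z => z) fun i => by fun_prop
    have h2 := (hind.indepFun h).comp measurable_id (Complex.continuous_conj.measurable)
    have h3 := h2.integral_fun_mul_eq_mul_integral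
      (measurable_pi_apply j).aestronglyMeasurable
      (Complex.continuous_conj.measurable.comp (measurable_pi_apply k)).aestronglyMeasurable
    simp only [Function.comp_apply, id] at h3
    rw [h3, integral_eval_pi_complexNormal, zero_mul]

theorem integral_norm_sq_sum_mul_pi_complexNormal (v : ι → ℝ≥0) (c : ι → ℂ) :
    ∫ z : ι → ℂ, ‖∑ j, c j * z j‖ ^ 2 ∂(Measure.pi fun j => complexNormal (v j)) =
      ∑ j, ‖c j‖ ^ 2 * v j := by
  classical
  have hpt : ∀ z : ι → ℂ, ((‖∑ j, c j * z j‖ ^ 2 : ℝ) : ℂ) =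
      ∑ j, ∑ k, (c j * starRingEnd ℂ (c k)) * (z j * starRingEnd ℂ (z k)) := by
    intro z
    rw [← Complex.normSq_eq_norm_sq, ← Complex.mul_conj, map_sum, Finset.sum_mul_sum]
    refine Finset.sum_congr rfl fun j _ => Finset.sum_congr rfl fun k _ => ?_
    rw [map_mul]
    ring
  have hint : ∀ j k, Integrable (fun z : ι → ℂ => (c j * starRingEnd ℂ (c k)) *
      (z j * starRingEnd ℂ (z k))) (Measure.pi fun j => complexNormal (v j)) := fun j k =>
    ((memLp_eval_pi_complexNormal v j).integrable_mul
      (memLp_eval_pi_complexNormal v k).star).const_mul _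
  apply Complex.ofReal_injective
  rw [← integral_complex_ofReal]
  simp_rw [hpt]
  rw [integral_finsetSum _ fun j _ => integrable_finsetSum _ fun k _ => hint j k]
  push_cast
  refine Finset.sum_congr rfl fun j _ => ?_
  rw [integral_finsetSum _ fun k _ => hint j k]
  simp_rw [integral_const_mul, integral_eval_mul_conj_eval_pi_complexNormal]
  simp [Complex.mul_conj, Complex.normSq_eq_norm_sq]

theorem integral_norm_sq_eval_pi_complexNormal (v : ι → ℝ≥0) (i : ι) :
    ∫ z : ι → ℂ, ‖z i‖ ^ 2 ∂(Measure.pi fun j => complexNormal (v j)) = v i := by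
  rw [integral_comp_eval (μ := fun j => complexNormal (v j)) (f := fun z : ℂ => ‖z‖ ^ 2)
    (by fun_prop), integral_norm_sq_complexNormal]

theorem integral_norm_add_sq_prod {α β : Type*} [MeasurableSpace α] [MeasurableSpace β]
    {μ : Measure α} {ν : Measure β} [IsProbabilityMeasure μ] [IsProbabilityMeasure ν]
    {f : α → ℂ} {g : β → ℂ} (hf : MemLp f 2 μ) (hg : MemLp g 2 ν) (hg0 : ∫ y, g y ∂ν = 0) :
    ∫ p, ‖f p.1 + g p.2‖ ^ 2 ∂(μ.prod ν) = ∫ x, ‖f x‖ ^ 2 ∂μ + ∫ y, ‖g y‖ ^ 2 ∂ν := by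
  have hpt : ∀ p : α × β, ‖f p.1 + g p.2‖ ^ 2 = ‖f p.1‖ ^ 2 + ‖g p.2‖ ^ 2 +
      2 * (f p.1 * starRingEnd ℂ (g p.2)).re := by
    intro p
    simp only [← Complex.normSq_eq_norm_sq, Complex.normSq_add]
  have h1 : Integrable (fun p : α × β => ‖f p.1‖ ^ 2) (μ.prod ν) :=
    hf.integrable_norm_pow'.comp_fst ν
  have h2 : Integrable (fun p : α × β => ‖g p.2‖ ^ 2) (μ.prod ν) :=
    hg.integrable_norm_pow'.comp_snd μ
  have h3 : Integrable (fun p : α × β => f p.1 * starRingEnd ℂ (g p.2)) (μ.prod ν) :=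
    (hf.integrable one_le_two).mul_prod (hg.star.integrable one_le_two)
  simp_rw [hpt]
  have h12 : Integrable (fun p : α × β => ‖f p.1‖ ^ 2 + ‖g p.2‖ ^ 2) (μ.prod ν) := h1.add h2
  have h5 : Integrable (fun p : α × β => 2 * (f p.1 * starRingEnd ℂ (g p.2)).re) (μ.prod ν) :=
    h3.re.const_mul 2
  rw [integral_add h12 h5, integral_add h1 h2, integral_const_mul]
  have h4 : ∫ p : α × β, (f p.1 * starRingEnd ℂ (g p.2)).re ∂(μ.prod ν) = 0 := by
    have := integral_re h3
    simp only [RCLike.re_to_complex] at this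
    rw [this, integral_prod_mul f fun y => starRingEnd ℂ (g y), integral_conj, hg0]
    simp
  rw [h4, integral_fun_fst (fun x => ‖f x‖ ^ 2), integral_fun_snd (fun y => ‖g y‖ ^ 2)]
  simp

end SecondMoments

/-! ### Domination of the translates of Gaussian noise -/

open GaussianRelayNetwork (iidInput)

section GaussianChannel

variable {a b : Type*} [Fintype a] [Fintype b]

/-- The Laplace transform `∫ exp (-∑ j, |(u η) j|² / v j) dγ(η)` of the energy of the signal
`u η`, relative to the noise variances `v`, under i.i.d. `CN(0, 1)` inputs. A coordinate with
`v j = 0` does not contribute. -/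
noncomputable def gaussianLaplace (u : (a → ℂ) →ₗ[ℂ] (b → ℂ)) (v : b → ℝ≥0) : ℝ≥0∞ :=
  ∫⁻ η, ENNReal.ofReal (Real.exp (-∑ j, ‖u η j‖ ^ 2 / v j)) ∂iidInput a

theorem measurable_linearMap_apply (u : (a → ℂ) →ₗ[ℂ] (b → ℂ)) : Measurable u :=
  u.continuous_of_finiteDimensional.measurable

theorem gaussianLaplace_le_one (u : (a → ℂ) →ₗ[ℂ] (b → ℂ)) (v : b → ℝ≥0) :
    gaussianLaplace u v ≤ 1 := by
  calc gaussianLaplace u v ≤ ∫⁻ _, 1 ∂iidInput a := by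
        refine lintegral_mono fun η => ?_
        rw [ENNReal.ofReal_le_one, Real.exp_le_one_iff, neg_nonpos]
        positivity
    _ = 1 := by simp

theorem gaussianLaplace_ne_top (u : (a → ℂ) →ₗ[ℂ] (b → ℂ)) (v : b → ℝ≥0) :
    gaussianLaplace u v ≠ ∞ :=
  ((gaussianLaplace_le_one u v).trans_lt ENNReal.one_lt_top).ne

theorem gaussianLaplace_ne_zero (u : (a → ℂ) →ₗ[ℂ] (b → ℂ)) (v : b → ℝ≥0) :
    gaussianLaplace u v ≠ 0 := by
  have hu := measurable_linearMap_apply u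
  rw [gaussianLaplace, Ne, lintegral_eq_zero_iff (by fun_prop)]
  intro h
  obtain ⟨η, hη⟩ := h.exists
  simp only [Pi.zero_apply, ENNReal.ofReal_eq_zero] at hη
  exact absurd hη (Real.exp_pos _).not_ge

theorem iidInput_map_neg : (iidInput a).map (fun z => -z) = iidInput a :=
  pi_complexNormal_map_neg fun _ => 1

/-- An odd term in the exponent increases the integral against a symmetric law, since
`cosh ≥ 1`. -/
theorem lintegral_exp_neg_le_lintegral_exp_sub {l q : (a → ℂ) → ℝ} (hl : Measurable l)
    (hq : Measurable q) (hl' : ∀ η, l (-η) = -l η) (hq' : ∀ η, q (-η) = q η) :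
    ∫⁻ η, ENNReal.ofReal (Real.exp (-q η)) ∂iidInput a ≤
      ∫⁻ η, ENNReal.ofReal (Real.exp (l η - q η)) ∂iidInput a := by
  have hsymm : ∫⁻ η, ENNReal.ofReal (Real.exp (l η - q η)) ∂iidInput a =
      ∫⁻ η, ENNReal.ofReal (Real.exp (-l η - q η)) ∂iidInput a := by
    conv_lhs => rw [← iidInput_map_neg]
    rw [lintegral_map (by fun_prop) (by fun_prop)]
    simp_rw [hl', hq']
  have h2 : 2 * ∫⁻ η, ENNReal.ofReal (Real.exp (-q η)) ∂iidInput a ≤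
      2 * ∫⁻ η, ENNReal.ofReal (Real.exp (l η - q η)) ∂iidInput a := by
    conv_rhs => rw [two_mul]
    conv_rhs =>
      arg 2
      rw [hsymm]
    rw [← lintegral_add_left (by fun_prop), ← lintegral_const_mul _ (by fun_prop)]
    refine lintegral_mono fun η => ?_
    rw [← ENNReal.ofReal_add (Real.exp_pos _).le (Real.exp_pos _).le,
      show (2 : ℝ≥0∞) = ENNReal.ofReal 2 by simp, ← ENNReal.ofReal_mul zero_le_two]
    refine ENNReal.ofReal_le_ofReal ?_
    rw [sub_eq_add_neg, sub_eq_add_neg, Real.exp_add, Real.exp_add, ← add_mul]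
    refine mul_le_mul_of_nonneg_right ?_ (Real.exp_pos _).le
    have := Real.one_le_cosh (l η)
    rw [Real.cosh_eq] at this
    linarith
  exact (ENNReal.mul_le_mul_iff_right two_ne_zero ENNReal.ofNat_ne_top).1 h2

/-- A lower bound on the density of the output law relative to the noise law. The substitution
`ξ = η + x` in the integral produces the density of the output given `x`, the factor `exp (-‖x‖²)`,
and an integrand that differs from that of `gaussianLaplace` only by an odd exponent. -/
theorem gaussianLaplace_mul_exp_le_lintegral (u : (a → ℂ) →ₗ[ℂ] (b → ℂ)) (v : b → ℝ≥0)
    (x : a → ℂ) (y : b → ℂ) :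
    gaussianLaplace u v * ENNReal.ofReal (Real.exp
        (∑ j, (2 * (starRingEnd ℂ (u x j) * y j).re - ‖u x j‖ ^ 2) / v j)) ≤
      ENNReal.ofReal (Real.exp (∑ i, ‖x i‖ ^ 2)) *
        ∫⁻ ξ, ENNReal.ofReal (Real.exp
          (∑ j, (2 * (starRingEnd ℂ (u ξ j) * y j).re - ‖u ξ j‖ ^ 2) / v j)) ∂iidInput a := by
  have hu := measurable_linearMap_apply u
  have hconj : Measurable (starRingEnd ℂ) := Complex.continuous_conj.measurable
  set ℓ : (a → ℂ) → ℝ := fun ξ =>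
    ∑ j, (2 * (starRingEnd ℂ (u ξ j) * y j).re - ‖u ξ j‖ ^ 2) / v j with hℓ
  have hℓm : Measurable ℓ := by fun_prop
  set l : (a → ℂ) → ℝ := fun η => (∑ j, 2 * (starRingEnd ℂ (u η j) * (y j - u x j)).re / v j) -
    ∑ i, 2 * (starRingEnd ℂ (x i) * η i).re with hl
  have hlm : Measurable l := by fun_prop
  have hCM : (iidInput a).map (· + -x) = (iidInput a).withDensity fun η => ENNReal.ofReal
      (Real.exp (∑ i, (2 * (starRingEnd ℂ (-x i) * η i).re - ‖-x i‖ ^ 2) / (1 : ℝ≥0))) :=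
    pi_complexNormal_map_add_const_eq_withDensity (v := fun _ => 1) (u := -x) (by simp)
  -- substitute `ξ = η + x`; the cross terms are collected in the odd function `l`
  have hshift : ∫⁻ ξ, ENNReal.ofReal (Real.exp (ℓ ξ)) ∂iidInput a =
      ENNReal.ofReal (Real.exp (ℓ x - ∑ i, ‖x i‖ ^ 2)) *
        ∫⁻ η, ENNReal.ofReal (Real.exp (l η - ∑ j, ‖u η j‖ ^ 2 / v j)) ∂iidInput a := by
    have h1 : ∫⁻ ξ, ENNReal.ofReal (Real.exp (ℓ ξ)) ∂iidInput a =
        ∫⁻ η, ENNReal.ofReal (Real.exp (ℓ (η + x))) ∂((iidInput a).map (· + -x)) := by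
      rw [lintegral_map (by fun_prop) (by fun_prop)]
      simp
    rw [h1, hCM, lintegral_withDensity_eq_lintegral_mul _ (by fun_prop) (by fun_prop),
      ← lintegral_const_mul _ (by fun_prop)]
    refine lintegral_congr fun η => ?_
    simp only [Pi.mul_apply]
    rw [← ENNReal.ofReal_mul (Real.exp_pos _).le, ← ENNReal.ofReal_mul (Real.exp_pos _).le,
      ← Real.exp_add, ← Real.exp_add]
    congr 2
    have e1 : ∀ j, (2 * (starRingEnd ℂ (u (η + x) j) * y j).re - ‖u (η + x) j‖ ^ 2) / (v j : ℝ) =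
        (2 * (starRingEnd ℂ (u x j) * y j).re - ‖u x j‖ ^ 2) / v j +
        (2 * (starRingEnd ℂ (u η j) * (y j - u x j)).re / v j - ‖u η j‖ ^ 2 / v j) := by
      intro j
      simp only [map_add, Pi.add_apply, ← Complex.normSq_eq_norm_sq, Complex.normSq_apply,
        Complex.add_re, Complex.add_im, Complex.mul_re, Complex.conj_re, Complex.conj_im,
        Complex.sub_re, Complex.sub_im]
      ring
    have e2 : ∀ i, (2 * (starRingEnd ℂ (-x i) * η i).re - ‖-x i‖ ^ 2) / ((1 : ℝ≥0) : ℝ) =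
        -(2 * (starRingEnd ℂ (x i) * η i).re) - ‖x i‖ ^ 2 := by
      intro i
      simp
      ring
    simp only [hℓ, hl, e1, e2, Finset.sum_add_distrib, Finset.sum_sub_distrib,
      Finset.sum_neg_distrib]
    ring
  rw [hshift, ← mul_assoc, ← ENNReal.ofReal_mul (Real.exp_pos _).le, ← Real.exp_add,
    add_sub_cancel, mul_comm]
  refine mul_le_mul_right ?_ _
  refine lintegral_exp_neg_le_lintegral_exp_sub hlm (by fun_prop) ?_ ?_
  · intro η
    simp only [hl, map_neg, Pi.neg_apply, neg_mul, mul_neg, Complex.neg_re, neg_div,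
      Finset.sum_neg_distrib]
    ring
  · intro η
    simp

/-- The output law given the input `x` is at most `exp (‖x‖²) / gaussianLaplace u v` times the
output law under i.i.d. `CN(0, 1)` inputs. -/
theorem gaussianLaplace_mul_map_add_le (u : (a → ℂ) →ₗ[ℂ] (b → ℂ)) (v : b → ℝ≥0)
    (huv : ∀ x j, v j = 0 → u x j = 0) (x : a → ℂ) {S : Set (b → ℂ)} (hS : MeasurableSet S) :
    gaussianLaplace u v * (Measure.pi fun j => complexNormal (v j)) ((· + u x) ⁻¹' S) ≤
      ENNReal.ofReal (Real.exp (∑ i, ‖x i‖ ^ 2)) *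
        (((iidInput a).prod (Measure.pi fun j => complexNormal (v j))).map
          fun p => u p.1 + p.2) S := by
  have hu := measurable_linearMap_apply u
  have hconj : Measurable (starRingEnd ℂ) := Complex.continuous_conj.measurable
  set ν := Measure.pi fun j => complexNormal (v j) with hν
  have hCM : ∀ ξ, ν ((· + u ξ) ⁻¹' S) = ∫⁻ y in S, ENNReal.ofReal (Real.exp
      (∑ j, (2 * (starRingEnd ℂ (u ξ j) * y j).re - ‖u ξ j‖ ^ 2) / v j)) ∂ν := by
    intro ξ
    rw [← Measure.map_apply (by fun_prop) hS,
      pi_complexNormal_map_add_const_eq_withDensity (huv ξ), withDensity_apply _ hS]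
  have hadd : Measurable fun p : (a → ℂ) × (b → ℂ) => u p.1 + p.2 := by fun_prop
  have hQ : ((iidInput a).prod ν).map (fun p => u p.1 + p.2) S =
      ∫⁻ ξ, ν ((· + u ξ) ⁻¹' S) ∂iidInput a := by
    rw [Measure.map_apply hadd hS, Measure.prod_apply (hadd hS)]
    refine lintegral_congr fun ξ => ?_
    congr 1
    ext y
    simp [add_comm]
  have hm : Measurable fun p : (a → ℂ) × (b → ℂ) => ENNReal.ofReal (Real.exp
      (∑ j, (2 * (starRingEnd ℂ (u p.1 j) * p.2 j).re - ‖u p.1 j‖ ^ 2) / v j)) := by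
    have : ∀ j, Measurable fun p : (a → ℂ) × (b → ℂ) => u p.1 j := fun j => by fun_prop
    fun_prop
  rw [hQ]
  simp_rw [hCM]
  rw [lintegral_lintegral_swap hm.aemeasurable, ← lintegral_const_mul _ (by fun_prop),
    ← lintegral_const_mul _ hm.lintegral_prod_left']
  exact lintegral_mono fun y => gaussianLaplace_mul_exp_le_lintegral u v x y

end GaussianChannel

/-! ### Bounds on the information through a Gaussian channel -/

section GaussianChannelInformation

variable {a b : Type*} [Fintype a] [Fintype b]
  {T γ : Type*} [MeasurableSpace T] [MeasurableSpace γ]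
  {A : T → b → ℂ} {B : T → a → ℂ} {C : T → γ} {Z : T → b → ℂ} {μ : Measure T}
  [IsProbabilityMeasure μ]

/-- Upper bound on `I(A; B | C)` when `A` is `s C + u B` plus independent Gaussian noise, for an
arbitrary joint law of `B` and `C`. -/
theorem condMutualInfo_le_of_gaussian_noise (u : (a → ℂ) →ₗ[ℂ] (b → ℂ)) (v : b → ℝ≥0)
    (huv : ∀ x j, v j = 0 → u x j = 0) {s : γ → b → ℂ} (hs : Measurable s)
    (hB : Measurable B) (hC : Measurable C) (hZ : Measurable Z)
    (hAZ : ∀ t, A t = s (C t) + u (B t) + Z t)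
    (hZlaw : μ.map Z = Measure.pi fun j => complexNormal (v j))
    (hind : IndepFun (fun t => (C t, B t)) Z μ)
    (hint : Integrable (fun t => ∑ i, ‖B t i‖ ^ 2) μ) :
    condMutualInfo A B C μ ≤
      ENNReal.ofReal (∫ t, ∑ i, ‖B t i‖ ^ 2 ∂μ - Real.log (gaussianLaplace u v).toReal) /
        ENNReal.ofReal (Real.log 2) := by
  have hu := measurable_linearMap_apply u
  have hA : Measurable A := by
    rw [funext hAZ]
    fun_prop
  set ν := Measure.pi fun j => complexNormal (v j) with hν
  set J := gaussianLaplace u v with hJ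
  have hJ0 : J ≠ 0 := gaussianLaplace_ne_zero u v
  have hJt : J ≠ ∞ := gaussianLaplace_ne_top u v
  have hJpos : 0 < J.toReal := ENNReal.toReal_pos hJ0 hJt
  set Q₀ := ((iidInput a).prod ν).map (fun p => u p.1 + p.2) with hQ₀
  have hQ₀p : IsProbabilityMeasure Q₀ := Measure.isProbabilityMeasure_map (by fun_prop)
  set Q : Kernel γ (b → ℂ) :=
    (Kernel.deterministic s hs ×ₖ Kernel.const γ Q₀).map (fun p => p.1 + p.2) with hQ
  have hQm : IsMarkovKernel Q := Kernel.IsMarkovKernel.map _ (by fun_prop)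
  have hQapp : ∀ c S, MeasurableSet S → Q c S = Q₀ ((s c + ·) ⁻¹' S) := by
    intro c S hS
    have hadd : Measurable fun p : (b → ℂ) × (b → ℂ) => p.1 + p.2 := by fun_prop
    rw [hQ, Kernel.map_apply' _ hadd _ hS, Kernel.prod_apply, Kernel.deterministic_apply,
      Kernel.const_apply, Measure.dirac_prod, Measure.map_apply (by fun_prop) (hadd hS)]
    rfl
  refine (condMutualInfo_le_klDiv hA hB hC Q).trans (ENNReal.div_le_div_right ?_ _)
  have hABC : Measurable fun t => (C t, (A t, B t)) := by fun_prop
  have hPp : IsProbabilityMeasure (μ.map fun t => (C t, (A t, B t))) :=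
    Measure.isProbabilityMeasure_map hABC.aemeasurable
  have hCp : IsProbabilityMeasure (μ.map C) := Measure.isProbabilityMeasure_map hC.aemeasurable
  set φ : γ × (b → ℂ) × (a → ℂ) → ℝ := fun p => ∑ i, ‖p.2.2 i‖ ^ 2 - Real.log J.toReal with hφ
  have hφm : Measurable φ := by fun_prop
  have hφint : Integrable φ (μ.map fun t => (C t, (A t, B t))) := by
    rw [integrable_map_measure hφm.aestronglyMeasurable hABC.aemeasurable]
    exact hint.sub (integrable_const _)
  have hφval : ∫ p, φ p ∂(μ.map fun t => (C t, (A t, B t))) =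
      ∫ t, ∑ i, ‖B t i‖ ^ 2 ∂μ - Real.log J.toReal := by
    rw [integral_map hABC.aemeasurable hφm.aestronglyMeasurable]
    simp only [hφ]
    rw [integral_sub hint (integrable_const _)]
    simp
  have hexp : ∀ p, ENNReal.ofReal (Real.exp (φ p)) =
      ENNReal.ofReal (Real.exp (∑ i, ‖p.2.2 i‖ ^ 2)) / J := by
    intro p
    rw [hφ, Real.exp_sub, Real.exp_log hJpos, ENNReal.ofReal_div_of_pos hJpos,
      ENNReal.ofReal_toReal hJt]
  rw [← hφval]
  refine klDiv_le_of_le_withDensity hφint ?_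
  refine Measure.le_iff.2 fun S hS => ?_
  rw [withDensity_apply _ hS, ← lintegral_indicator hS, Measure.lintegral_compProd
    (hφm.exp.ennreal_ofReal.indicator hS)]
  -- the joint law as an average over the inputs
  have hjoint : μ.map (fun t => ((C t, B t), Z t)) = (μ.map fun t => (C t, B t)).prod ν := by
    rw [(indepFun_iff_map_prod_eq_prod_map_map (by fun_prop) hZ.aemeasurable).1 hind, hZlaw]
  have hg : Measurable fun p : (γ × (a → ℂ)) × (b → ℂ) =>
      (p.1.1, (s p.1.1 + u p.1.2 + p.2, p.1.2)) := by fun_prop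
  have hlaw : μ.map (fun t => (C t, (A t, B t))) =
      ((μ.map C ⊗ₘ condDistrib B C μ).prod ν).map
        fun p => (p.1.1, (s p.1.1 + u p.1.2 + p.2, p.1.2)) := by
    rw [compProd_map_condDistrib hB.aemeasurable, ← hjoint, Measure.map_map hg (by fun_prop)]
    congr 1
    ext1 t
    simp [hAZ]
  have hlhs : μ.map (fun t => (C t, (A t, B t))) S = ∫⁻ c, ∫⁻ x,
      ν ((· + u x) ⁻¹' ((s c + ·) ⁻¹' {y | (c, (y, x)) ∈ S})) ∂condDistrib B C μ c ∂μ.map C := by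
    rw [hlaw, Measure.map_apply hg hS, Measure.prod_apply (hg hS), Measure.lintegral_compProd
      (measurable_measure_prodMk_left (hg hS))]
    refine lintegral_congr fun c => lintegral_congr fun x => ?_
    congr 1
    ext z
    simp [add_assoc, add_comm z]
  rw [hlhs]
  refine lintegral_mono fun c => ?_
  have hSc : Measurable fun p : (b → ℂ) × (a → ℂ) => (c, p) := by fun_prop
  rw [Kernel.prod_apply, lintegral_prod_symm _ (by
    exact ((hφm.exp.ennreal_ofReal.indicator hS).comp hSc).aemeasurable)]
  refine lintegral_mono fun x => ?_
  have hScx : MeasurableSet {y | (c, (y, x)) ∈ S} :=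
    (by fun_prop : Measurable fun y : b → ℂ => (c, (y, x))) hS
  have hScx' : MeasurableSet ((s c + ·) ⁻¹' {y | (c, (y, x)) ∈ S}) :=
    (by fun_prop : Measurable fun y : b → ℂ => s c + y) hScx
  have hinner : ∫⁻ y, S.indicator (fun p => ENNReal.ofReal (Real.exp (φ p))) (c, (y, x)) ∂Q c =
      ENNReal.ofReal (Real.exp (∑ i, ‖x i‖ ^ 2)) / J *
        Q₀ ((s c + ·) ⁻¹' {y | (c, (y, x)) ∈ S}) := by
    rw [← hQapp c _ hScx, ← lintegral_indicator_const hScx]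
    refine lintegral_congr fun y => ?_
    by_cases hy : (c, (y, x)) ∈ S
    · rw [Set.indicator_of_mem hy, Set.indicator_of_mem (by exact hy), hexp]
    · rw [Set.indicator_of_notMem hy, Set.indicator_of_notMem (by exact hy)]
  rw [hinner, ENNReal.mul_comm_div, ← mul_div_assoc,
    ENNReal.le_div_iff_mul_le (Or.inl hJ0) (Or.inl hJt), mul_comm _ J]
  exact gaussianLaplace_mul_map_add_le u v huv x hScx'

/-- The Gaussian with precision `1 + hᴴ h` centred at `w`, written relative to i.i.d. `CN(0, 1)`
variables, has the same normalization for all `w`. -/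
theorem lintegral_exp_neg_translate (h : (a → ℂ) →ₗ[ℂ] (b → ℂ)) (w : a → ℂ) :
    ∫⁻ x, ENNReal.ofReal (Real.exp (∑ i, ‖x i‖ ^ 2 - ∑ i, ‖x i - w i‖ ^ 2 -
      ∑ j, ‖h (x - w) j‖ ^ 2)) ∂iidInput a = gaussianLaplace h 1 := by
  have hu := measurable_linearMap_apply h
  have hconj : Measurable (starRingEnd ℂ) := Complex.continuous_conj.measurable
  have hCM : (iidInput a).map (· + w) = (iidInput a).withDensity fun x => ENNReal.ofReal
      (Real.exp (∑ i, (2 * (starRingEnd ℂ (w i) * x i).re - ‖w i‖ ^ 2) / (1 : ℝ≥0))) :=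
    pi_complexNormal_map_add_const_eq_withDensity (v := fun _ => 1) (by simp)
  have h1 : gaussianLaplace h 1 = ∫⁻ x, ENNReal.ofReal (Real.exp (-∑ j, ‖h (x - w) j‖ ^ 2))
      ∂((iidInput a).map (· + w)) := by
    rw [lintegral_map (by fun_prop) (by fun_prop)]
    simp [gaussianLaplace]
  rw [h1, hCM, lintegral_withDensity_eq_lintegral_mul _ (by fun_prop) (by fun_prop)]
  refine lintegral_congr fun x => ?_
  simp only [Pi.mul_apply]
  rw [← ENNReal.ofReal_mul (Real.exp_pos _).le, ← Real.exp_add, sub_eq_add_neg,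
    ← Finset.sum_sub_distrib]
  congr 3
  refine Finset.sum_congr rfl fun i _ => ?_
  simp only [← Complex.normSq_eq_norm_sq, Complex.normSq_apply, Complex.mul_re, Complex.conj_re,
    Complex.conj_im, Complex.sub_re, Complex.sub_im, NNReal.coe_one]
  ring

/-- Lower bound on `I(A; B | C)` for i.i.d. `CN(0, 1)` variables `B` independent of `C`, from any
estimator `e` of `B`. The test function is the logarithm of the density of the Gaussian with
precision `1 + hᴴ h` centred at the estimate. -/
theorem le_condMutualInfo_of_iidInput {α : Type*} [MeasurableSpace α] [StandardBorelSpace α]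
    [Nonempty α] {A : T → α} (hA : Measurable A) (hB : Measurable B) (hC : Measurable C)
    (hBlaw : μ.map B = iidInput a) (hind : IndepFun C B μ) (h : (a → ℂ) →ₗ[ℂ] (b → ℂ))
    {e : γ → α → a → ℂ} (he : Measurable (Function.uncurry e))
    (hint : Integrable (fun t => ∑ i, ‖B t i‖ ^ 2) μ)
    (hint₁ : Integrable (fun t => ∑ i, ‖B t i - e (C t) (A t) i‖ ^ 2) μ)
    (hint₂ : Integrable (fun t => ∑ j, ‖h (B t - e (C t) (A t)) j‖ ^ 2) μ) :
    ENNReal.ofReal (∫ t, ∑ i, ‖B t i‖ ^ 2 ∂μ - ∫ t, ∑ i, ‖B t i - e (C t) (A t) i‖ ^ 2 ∂μ -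
        ∫ t, ∑ j, ‖h (B t - e (C t) (A t)) j‖ ^ 2 ∂μ - Real.log (gaussianLaplace h 1).toReal) /
      ENNReal.ofReal (Real.log 2) ≤ condMutualInfo A B C μ := by
  have hu := measurable_linearMap_apply h
  refine ENNReal.div_le_div_right ?_ _
  set J := gaussianLaplace h 1 with hJ
  have hJ0 : J ≠ 0 := gaussianLaplace_ne_zero h 1
  have hJt : J ≠ ∞ := gaussianLaplace_ne_top h 1
  have hJpos : 0 < J.toReal := ENNReal.toReal_pos hJ0 hJt
  have hABC : Measurable fun t => (C t, (A t, B t)) := by fun_prop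
  have hPp : IsProbabilityMeasure (μ.map fun t => (C t, (A t, B t))) :=
    Measure.isProbabilityMeasure_map hABC.aemeasurable
  have hCp : IsProbabilityMeasure (μ.map C) := Measure.isProbabilityMeasure_map hC.aemeasurable
  set ψ : γ × α × (a → ℂ) → ℝ := fun p => ∑ i, ‖p.2.2 i‖ ^ 2 -
    ∑ i, ‖p.2.2 i - e p.1 p.2.1 i‖ ^ 2 - ∑ j, ‖h (p.2.2 - e p.1 p.2.1) j‖ ^ 2 with hψ
  have he' : Measurable fun p : γ × α × (a → ℂ) => e p.1 p.2.1 :=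
    he.comp (by fun_prop : Measurable fun p : γ × α × (a → ℂ) => (p.1, p.2.1))
  have hψm : Measurable ψ := by fun_prop
  have hψint : Integrable (fun t => ψ (C t, (A t, B t))) μ := (hint.sub hint₁).sub hint₂
  have hint' : Integrable (fun p => ψ p - Real.log J.toReal)
      (μ.map fun t => (C t, (A t, B t))) := by
    rw [integrable_map_measure (by fun_prop) hABC.aemeasurable]
    exact hψint.sub (integrable_const _)
  have hval : ∫ p, (ψ p - Real.log J.toReal) ∂(μ.map fun t => (C t, (A t, B t))) =
      ∫ t, ∑ i, ‖B t i‖ ^ 2 ∂μ - ∫ t, ∑ i, ‖B t i - e (C t) (A t) i‖ ^ 2 ∂μ -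
        ∫ t, ∑ j, ‖h (B t - e (C t) (A t)) j‖ ^ 2 ∂μ - Real.log J.toReal := by
    have hsub : Integrable (fun t => ∑ i, ‖B t i‖ ^ 2 -
      ∑ i, ‖B t i - e (C t) (A t) i‖ ^ 2) μ := hint.sub hint₁
    rw [integral_map hABC.aemeasurable (by fun_prop), integral_sub hψint (integrable_const _)]
    simp only [hψ]
    rw [integral_sub hsub hint₂, integral_sub hint hint₁]
    simp
  rw [← hval]
  refine ofReal_integral_le_klDiv (by fun_prop) hint' ?_
  -- as `B` has law `iidInput a` given `C`, the test function integrates to `1` over `B` alone, so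
  -- the conditional law of `A` plays no role
  have hcond : condDistrib B C μ =ᵐ[μ.map C] Kernel.const γ (iidInput a) := by
    refine condDistrib_ae_eq_of_measure_eq_compProd C hB.aemeasurable ?_
    rw [(indepFun_iff_map_prod_eq_prod_map_map hC.aemeasurable hB.aemeasurable).1 hind, hBlaw,
      Measure.compProd_const]
  rw [Measure.lintegral_compProd (by fun_prop)]
  calc _ ≤ ∫⁻ _, 1 ∂μ.map C := by
        refine lintegral_mono_ae ?_
        filter_upwards [hcond] with c hc
        rw [Kernel.prod_apply, hc, Kernel.const_apply, lintegral_prod _ (by fun_prop)]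
        calc _ ≤ ∫⁻ _, 1 ∂condDistrib A C μ c := by
              refine lintegral_mono fun y => ?_
              have := lintegral_exp_neg_translate h (e c y)
              simp_rw [Real.exp_sub _ (Real.log _), Real.exp_log hJpos,
                ENNReal.ofReal_div_of_pos hJpos, ENNReal.ofReal_toReal hJt, div_eq_mul_inv]
              rw [lintegral_mul_const _ (by fun_prop), this, ENNReal.mul_inv_cancel hJ0 hJt]
          _ = 1 := by simp
    _ = 1 := by simp

end GaussianChannelInformation

/-! ### The linear estimator -/

section LinearEstimation

open Matrix
open scoped ComplexOrder

variable {a b c : Type*} [Fintype a] [Fintype b]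

theorem mul_conjTranspose_apply_self (M : Matrix c a ℂ) (j : c) :
    (M * Mᴴ) j j = ((∑ i, ‖M j i‖ ^ 2 : ℝ) : ℂ) := by
  simp [Matrix.mul_apply, Complex.mul_conj, Complex.normSq_eq_norm_sq]

/-- With `G = (1 + Bᴴ B)⁻¹`, the identity `M G (1 + Bᴴ B) Gᴴ Mᴴ = M G Mᴴ`, read on the diagonal. -/
theorem sum_norm_sq_estimator_row [DecidableEq a] {B : Matrix b a ℂ} {G : Matrix a a ℂ}
    (hGN : G * (1 + Bᴴ * B) = 1) (hGH : Gᴴ = G) (M : Matrix c a ℂ) (j : c) :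
    ((∑ k, ‖(M * G) j k‖ ^ 2 + ∑ k, ‖(M * (G * Bᴴ)) j k‖ ^ 2 : ℝ) : ℂ) = (M * G * Mᴴ) j j := by
  rw [Complex.ofReal_add, ← mul_conjTranspose_apply_self, ← mul_conjTranspose_apply_self,
    ← Matrix.add_apply]
  refine congrFun (congrFun ?_ j) j
  simp only [conjTranspose_mul, hGH, conjTranspose_conjTranspose]
  calc _ = M * (G * (1 + Bᴴ * B)) * (G * Mᴴ) := by
        simp only [Matrix.mul_add, Matrix.add_mul, Matrix.mul_one, Matrix.mul_assoc]
    _ = _ := by rw [hGN, Matrix.mul_one, Matrix.mul_assoc]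

/-- The contribution of one receiver, of gain energy at most `g`, to the weighted estimation
error. -/
theorem one_sub_mul_le_one_of_le {g q S d : ℝ} (hg : 0 ≤ g) (hd : d = g / (2 * g + 1))
    (hS : S + d * q ^ 2 ≤ q) (hq : q ^ 2 ≤ S * g) : (1 - d) * q ≤ 1 := by
  have hd1 : 1 - d = (g + 1) / (2 * g + 1) := by
    rw [hd]
    field_simp
    ring
  have hd0 : 0 ≤ d := by rw [hd]; positivity
  rcases le_or_gt q 0 with h0 | h0
  · have : 0 ≤ 1 - d := by rw [hd1]; positivity
    nlinarith
  · have h1 : q * (1 + d * g) ≤ g := by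
      have h2 : q ^ 2 * (1 + d * g) ≤ q * g := by nlinarith
      nlinarith
    have h3 : 1 + d * g = (g + 1) ^ 2 / (2 * g + 1) := by
      rw [hd]
      field_simp
      ring
    rw [h3, ← mul_div_assoc, div_le_iff₀ (by positivity)] at h1
    rw [hd1, div_mul_eq_mul_div, div_le_one (by positivity)]
    nlinarith

/-- For the channel with the rows of `H` scaled by `√d`, the matrix `K` of the minimum mean square
error estimator leaves the error matrix `R` on the input, and the errors `e` satisfy
`E ‖e‖² + E ‖H e‖² ≤ |a| + |b|`. With `G = (1 + Bᴴ B)⁻¹`, where `B` is the scaled matrix, the left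
side is `tr G + tr (H G Hᴴ)`, whereas `tr G + tr (B G Bᴴ) = |a|`. So receiver `j` contributes
`1 - d j` times the diagonal entry of `H G Hᴴ`. -/
theorem exists_linear_estimator [DecidableEq a] [DecidableEq b] (H : Matrix b a ℂ) (g d : b → ℝ)
    (hg : ∀ j, ∑ i, ‖H j i‖ ^ 2 ≤ g j) (hd : ∀ j, d j = g j / (2 * g j + 1)) :
    ∃ K : Matrix a b ℂ, ∃ R : Matrix a a ℂ,
      R + K * (diagonal (fun j => ((√(d j) : ℝ) : ℂ)) * H) = 1 ∧
      (∑ i, ∑ k, ‖R i k‖ ^ 2 + ∑ i, ∑ j, ‖K i j‖ ^ 2) +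
        (∑ j, ∑ k, ‖(H * R) j k‖ ^ 2 + ∑ j, ∑ k, ‖(H * K) j k‖ ^ 2) ≤
      Fintype.card a + Fintype.card b := by
  have hg0 : ∀ j, 0 ≤ g j := fun j => (by positivity : (0 : ℝ) ≤ _).trans (hg j)
  have hd0 : ∀ j, 0 ≤ d j := fun j => by rw [hd]; have := hg0 j; positivity
  set D : Matrix b b ℂ := diagonal (fun j => ((√(d j) : ℝ) : ℂ)) with hD
  have hDH : Dᴴ = D := by
    rw [hD, diagonal_conjTranspose]
    congr 1
    ext j
    simp
  have hDD : ∀ (M : Matrix b b ℂ) j, (D * M * D) j j = d j * M j j := by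
    intro M j
    rw [hD, mul_diagonal, diagonal_mul, mul_right_comm, ← Complex.ofReal_mul,
      Real.mul_self_sqrt (hd0 j)]
  set B := D * H with hB
  set N := 1 + Bᴴ * B with hN
  have hNpos : N.PosDef := PosDef.one.add_posSemidef (posSemidef_conjTranspose_mul_self B)
  have hdet : IsUnit N.det := (isUnit_iff_isUnit_det _).1 hNpos.isUnit
  set G := N⁻¹ with hG
  have hGN : G * N = 1 := nonsing_inv_mul N hdet
  have hNG : N * G = 1 := mul_nonsing_inv N hdet
  have hGH : Gᴴ = G := hNpos.isHermitian.inv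
  have hrow := fun j => sum_norm_sq_estimator_row hGN hGH H j
  have hrow1 := fun i => sum_norm_sq_estimator_row hGN hGH (1 : Matrix a a ℂ) i
  simp only [Matrix.one_mul, conjTranspose_one, Matrix.mul_one] at hrow1
  refine ⟨G * Bᴴ, G, by rw [Matrix.mul_assoc, ← hGN, hN, Matrix.mul_add, Matrix.mul_one], ?_⟩
  rw [← Finset.sum_add_distrib, ← Finset.sum_add_distrib]
  set q : b → ℝ := fun j => ∑ k, ‖(H * G) j k‖ ^ 2 + ∑ k, ‖(H * (G * Bᴴ)) j k‖ ^ 2 with hq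
  -- the trace of `G N = 1`
  have htr : ∑ i, (∑ k, ‖G i k‖ ^ 2 + ∑ k, ‖(G * Bᴴ) i k‖ ^ 2) + ∑ j, d j * q j =
      Fintype.card a := by
    apply Complex.ofReal_injective
    rw [Complex.ofReal_add, Complex.ofReal_sum, Complex.ofReal_sum]
    simp_rw [hrow1, Complex.ofReal_mul, hq, hrow, ← hDD]
    have h1 : D * (H * G * Hᴴ) * D = B * G * Bᴴ := by
      rw [hB, conjTranspose_mul, hDH]
      simp only [Matrix.mul_assoc]
    rw [h1]
    change G.trace + (B * G * Bᴴ).trace = _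
    rw [trace_mul_comm, ← Matrix.mul_assoc, ← trace_add]
    nth_rewrite 1 [← Matrix.one_mul G]
    rw [← Matrix.add_mul, ← hN, hNG, trace_one]
    simp
  -- `q j` is the sum of the squared norm `S` of row `j` of `H G` and of terms that include
  -- `d j * q j ^ 2`; as it is also the product of the rows `j` of `H G` and of `H`, the
  -- Cauchy-Schwarz inequality bounds `q j ^ 2` by `S * g j`
  have hqb : ∀ j, (1 - d j) * q j ≤ 1 := by
    intro j
    refine one_sub_mul_le_one_of_le (S := ∑ k, ‖(H * G) j k‖ ^ 2)
      (hg0 j) (hd j) ?_ ?_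
    · have h1 : (H * (G * Bᴴ)) j j = ((q j * √(d j) : ℝ) : ℂ) := by
        rw [hB, conjTranspose_mul, hDH, ← Matrix.mul_assoc, ← Matrix.mul_assoc, hD, mul_diagonal,
          ← hrow, Complex.ofReal_mul]
      have h2 : ‖(H * (G * Bᴴ)) j j‖ ^ 2 ≤ ∑ k, ‖(H * (G * Bᴴ)) j k‖ ^ 2 :=
        Finset.single_le_sum (f := fun k => ‖(H * (G * Bᴴ)) j k‖ ^ 2)
          (fun _ _ => by positivity) (Finset.mem_univ j)
      rw [h1, Complex.norm_real, Real.norm_eq_abs, sq_abs, mul_pow, Real.sq_sqrt (hd0 j)] at h2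
      simp only [hq] at h2 ⊢
      linarith
    · have h1 : ((q j : ℝ) : ℂ) = ∑ k, (H * G) j k * starRingEnd ℂ (H j k) := by
        simp only [hq]
        rw [hrow, Matrix.mul_apply]
        rfl
      have h2 : |q j| ≤ ∑ k, ‖(H * G) j k‖ * ‖H j k‖ := by
        rw [← Real.norm_eq_abs, ← Complex.norm_real, h1]
        refine (norm_sum_le _ _).trans_eq ?_
        simp
      calc q j ^ 2 = |q j| ^ 2 := (sq_abs _).symm
        _ ≤ (∑ k, ‖(H * G) j k‖ * ‖H j k‖) ^ 2 := by gcongr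
        _ ≤ (∑ k, ‖(H * G) j k‖ ^ 2) * ∑ k, ‖H j k‖ ^ 2 := Finset.sum_mul_sq_le_sq_mul_sq _ _ _
        _ ≤ _ := by
          have := hg j
          gcongr
  have hsum : ∑ j, q j ≤ ∑ j, d j * q j + Fintype.card b := by
    have : ∑ j, (1 - d j) * q j ≤ ∑ _j : b, (1 : ℝ) := Finset.sum_le_sum fun j _ => hqb j
    simp only [sub_mul, one_mul, Finset.sum_sub_distrib] at this
    simp at this
    linarith
  linarith

end LinearEstimation

/-! ### The estimation error -/

section EstimationError

variable {a b c : Type*} [Fintype a] [Fintype b] [Fintype c] {T γ : Type*} [MeasurableSpace T]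
  [MeasurableSpace γ] {μ : Measure T}

/-- The second moment of one coordinate of the estimation error. Only an inequality holds, since the
normalized noise `Z / √v` vanishes where `v = 0`. -/
theorem integral_norm_sq_error_le (v : b → ℝ≥0) {X : T → a → ℂ} {Z : T → b → ℂ}
    (hX : Measurable X) (hZ : Measurable Z)
    (hlaw : μ.map (fun t => (X t, Z t)) =
      (iidInput a).prod (Measure.pi fun j => complexNormal (v j))) (r : a → ℂ) (k : b → ℂ) :
    Integrable (fun t => ‖∑ i, r i * X t i - ∑ j, k j * (Z t j / (√(v j) : ℝ))‖ ^ 2) μ ∧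
      ∫ t, ‖∑ i, r i * X t i - ∑ j, k j * (Z t j / (√(v j) : ℝ))‖ ^ 2 ∂μ ≤
        ∑ i, ‖r i‖ ^ 2 + ∑ j, ‖k j‖ ^ 2 := by
  set k' : b → ℂ := fun j => -(k j / (√(v j) : ℝ)) with hk'
  have hpt : ∀ t, ‖∑ i, r i * X t i - ∑ j, k j * (Z t j / (√(v j) : ℝ))‖ ^ 2 =
      ‖∑ i, r i * X t i + ∑ j, k' j * Z t j‖ ^ 2 := by
    intro t
    rw [sub_eq_add_neg, ← Finset.sum_neg_distrib]
    congr 3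
    refine Finset.sum_congr rfl fun j _ => ?_
    simp only [hk']
    ring
  simp_rw [hpt]
  have hf : MemLp (fun x : a → ℂ => ∑ i, r i * x i) 2 (iidInput a) :=
    memLp_sum_mul_pi_complexNormal (fun _ => 1) r
  have hg := memLp_sum_mul_pi_complexNormal v k'
  have hXZ : Measurable fun t => (X t, Z t) := hX.prodMk hZ
  have hm : AEStronglyMeasurable (fun p : (a → ℂ) × (b → ℂ) =>
      ‖∑ i, r i * p.1 i + ∑ j, k' j * p.2 j‖ ^ 2) (μ.map fun t => (X t, Z t)) :=
    Measurable.aestronglyMeasurable (by fun_prop)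
  have hval : ∫ t, ‖∑ i, r i * X t i + ∑ j, k' j * Z t j‖ ^ 2 ∂μ =
      ∑ i, ‖r i‖ ^ 2 + ∑ j, ‖k' j‖ ^ 2 * v j := by
    rw [← integral_map (f := fun p : (a → ℂ) × (b → ℂ) =>
      ‖∑ i, r i * p.1 i + ∑ j, k' j * p.2 j‖ ^ 2) hXZ.aemeasurable hm, hlaw,
      integral_norm_add_sq_prod hf hg (integral_sum_mul_pi_complexNormal v k'),
      integral_norm_sq_sum_mul_pi_complexNormal]
    have := integral_norm_sq_sum_mul_pi_complexNormal (fun _ => 1) r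
    simp only [NNReal.coe_one, mul_one] at this
    rw [← this]
    rfl
  constructor
  · have hint : Integrable (fun p : (a → ℂ) × (b → ℂ) =>
        ‖∑ i, r i * p.1 i + ∑ j, k' j * p.2 j‖ ^ 2) (μ.map fun t => (X t, Z t)) := by
      rw [hlaw]
      exact ((hf.comp_fst _).add (hg.comp_snd _)).integrable_norm_pow'
    exact (integrable_map_measure hm hXZ.aemeasurable).1 hint
  · rw [hval]
    gcongr with j
    simp only [hk', norm_neg, norm_div, Complex.norm_real, Real.norm_eq_abs,
      abs_of_nonneg (Real.sqrt_nonneg _), div_pow, Real.sq_sqrt (v j).coe_nonneg]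
    rcases eq_or_ne (v j : ℝ) 0 with h0 | h0
    · rw [h0, mul_zero]
      positivity
    · rw [div_mul_cancel₀ _ h0]

theorem integral_sum_norm_sq_error_le (v : b → ℝ≥0) {X : T → a → ℂ} {Z : T → b → ℂ}
    (hX : Measurable X) (hZ : Measurable Z)
    (hlaw : μ.map (fun t => (X t, Z t)) =
      (iidInput a).prod (Measure.pi fun j => complexNormal (v j)))
    (R : Matrix c a ℂ) (K : Matrix c b ℂ) {E : T → c → ℂ}
    (hE : ∀ t l, E t l = ∑ i, R l i * X t i - ∑ j, K l j * (Z t j / (√(v j) : ℝ))) :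
    Integrable (fun t => ∑ l, ‖E t l‖ ^ 2) μ ∧
      ∫ t, ∑ l, ‖E t l‖ ^ 2 ∂μ ≤ ∑ l, ∑ i, ‖R l i‖ ^ 2 + ∑ l, ∑ j, ‖K l j‖ ^ 2 := by
  simp_rw [hE]
  have h := fun l => integral_norm_sq_error_le v hX hZ hlaw (R l) (K l)
  refine ⟨integrable_finsetSum _ fun l _ => (h l).1, ?_⟩
  rw [integral_finsetSum _ fun l _ => (h l).1, ← Finset.sum_add_distrib]
  exact Finset.sum_le_sum fun l _ => (h l).2

theorem integral_sum_norm_sq_of_map_eq_iidInput {X : T → a → ℂ} (hX : Measurable X)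
    (hlaw : μ.map X = iidInput a) :
    Integrable (fun t => ∑ i, ‖X t i‖ ^ 2) μ ∧
      ∫ t, ∑ i, ‖X t i‖ ^ 2 ∂μ = Fintype.card a := by
  have hi : ∀ i, Integrable (fun x : a → ℂ => ‖x i‖ ^ 2) (iidInput a) := fun i =>
    (memLp_eval_pi_complexNormal (fun _ => 1) i).integrable_norm_pow'
  have hs : Integrable (fun x : a → ℂ => ∑ i, ‖x i‖ ^ 2) (iidInput a) :=
    integrable_finsetSum _ fun i _ => hi i
  rw [← hlaw] at hs
  refine ⟨(integrable_map_measure hs.1 hX.aemeasurable).1 hs, ?_⟩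
  rw [← integral_map (f := fun x : a → ℂ => ∑ i, ‖x i‖ ^ 2) hX.aemeasurable hs.1, hlaw,
    integral_finsetSum _ fun i _ => hi i]
  have h1 : ∀ i, ∫ x : a → ℂ, ‖x i‖ ^ 2 ∂iidInput a = 1 :=
    integral_norm_sq_eval_pi_complexNormal fun _ => 1
  simp [h1]

open Matrix in
/-- Lower bound on `I(A; B | C)` when `A` is the signal `H B`, scaled by `√(v d)` with
`d = g / (2 g + 1)`, plus independent noise of variances `v`. -/
theorem le_condMutualInfo_of_gaussian_noise [IsProbabilityMeasure μ] {A : T → b → ℂ}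
    {B : T → a → ℂ} {C : T → γ} {Z : T → b → ℂ} (H : Matrix b a ℂ) (v : b → ℝ≥0) (g d : b → ℝ)
    (hg : ∀ j, ∑ i, ‖H j i‖ ^ 2 ≤ g j) (hd : ∀ j, d j = g j / (2 * g j + 1))
    (hvd : ∀ j, v j = 0 → d j = 0)
    {s : γ → b → ℂ} (hs : Measurable s)
    (hB : Measurable B) (hC : Measurable C) (hZ : Measurable Z)
    (hAZ : ∀ t j, A t j = s (C t) j + (√(v j * d j) : ℝ) * (H *ᵥ B t) j + Z t j)
    (hBlaw : μ.map B = iidInput a) (hCB : IndepFun C B μ)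
    (hZlaw : μ.map Z = Measure.pi fun j => complexNormal (v j))
    (hind : IndepFun (fun t => (C t, B t)) Z μ) :
    ENNReal.ofReal (-Real.log (gaussianLaplace H.mulVecLin 1).toReal - Fintype.card b) /
      ENNReal.ofReal (Real.log 2) ≤ condMutualInfo A B C μ := by
  classical
  obtain ⟨K, R, hRK, hle⟩ := exists_linear_estimator H g d hg hd
  have hA : Measurable A := by
    have : ∀ j, Measurable fun t => (H *ᵥ B t) j := fun j => by
      simp only [mulVec, dotProduct]
      fun_prop
    refine measurable_pi_lambda _ fun j => ?_
    simp_rw [hAZ]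
    fun_prop
  have hBZ : μ.map (fun t => (B t, Z t)) =
      (iidInput a).prod (Measure.pi fun j => complexNormal (v j)) := by
    have h1 : IndepFun B Z μ := hind.comp (φ := Prod.snd) (ψ := id) measurable_snd measurable_id
    rw [(indepFun_iff_map_prod_eq_prod_map_map hB.aemeasurable hZ.aemeasurable).1 h1, hBlaw, hZlaw]
  set e : γ → (b → ℂ) → a → ℂ := fun c y =>
    K *ᵥ fun j => (y j - s c j) / (√(v j) : ℝ) with he
  have hem : Measurable (Function.uncurry e) := by
    refine measurable_pi_lambda _ fun i => ?_
    simp only [he, Function.uncurry_def, mulVec, dotProduct]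
    fun_prop
  have herr : ∀ t, B t - e (C t) (A t) =
      R *ᵥ B t - K *ᵥ fun j => Z t j / (√(v j) : ℝ) := by
    intro t
    have h1 : (fun j => (A t j - s (C t) j) / ((√(v j) : ℝ) : ℂ)) =
        (diagonal (fun j => ((√(d j) : ℝ) : ℂ)) * H) *ᵥ B t +
          fun j => Z t j / (√(v j) : ℝ) := by
      ext j
      rw [hAZ, Pi.add_apply, ← mulVec_mulVec, mulVec_diagonal]
      rcases eq_or_ne (v j) 0 with h0 | h0
      · simp [h0, hvd j h0]
      · have h2 : ((√(v j) : ℝ) : ℂ) ≠ 0 := by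
          rw [Complex.ofReal_ne_zero, Real.sqrt_ne_zero']
          exact_mod_cast pos_iff_ne_zero.2 h0
        rw [Real.sqrt_mul (v j).coe_nonneg, Complex.ofReal_mul]
        field_simp
        ring
    rw [he]
    simp only [h1]
    rw [mulVec_add, mulVec_mulVec]
    have h2 : B t = R *ᵥ B t + (K * (diagonal (fun j => ((√(d j) : ℝ) : ℂ)) * H)) *ᵥ B t := by
      rw [← add_mulVec, hRK, one_mulVec]
    nth_rewrite 1 [h2]
    abel
  have h0 := integral_sum_norm_sq_of_map_eq_iidInput hB hBlaw
  have h1 := integral_sum_norm_sq_error_le (E := fun t i => B t i - e (C t) (A t) i)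
    v hB hZ hBZ R K (by
      intro t l
      exact congrFun (herr t) l)
  have h2 := integral_sum_norm_sq_error_le
    (E := fun t j => H.mulVecLin (B t - e (C t) (A t)) j) v hB hZ hBZ (H * R) (H * K) (by
      intro t l
      rw [herr, mulVecLin_apply, mulVec_sub, mulVec_mulVec, mulVec_mulVec]
      rfl)
  refine le_trans (ENNReal.div_le_div_right (ENNReal.ofReal_le_ofReal ?_) _)
    (le_condMutualInfo_of_iidInput hA hB hC hBlaw hCB H.mulVecLin hem h0.1 h1.1 h2.1)
  rw [h0.2]
  linarith [h1.2, h2.2]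

end EstimationError

/-! ### The effective gains and the quantization noise of a network -/

theorem map_restrict_prod_restrict_compl_pi {V : Type*} [Fintype V] {E : V → Type*}
    [∀ i, MeasurableSpace (E i)] (μ : ∀ i, Measure (E i)) [∀ i, SigmaFinite (μ i)] (S : Set V)
    [Fintype S] [Fintype ↥Sᶜ] :
    (Measure.pi μ).map (fun x => ((fun i : S => x i), (fun i : ↥Sᶜ => x i))) =
      (Measure.pi fun i : S => μ i).prod (Measure.pi fun i : ↥Sᶜ => μ i) := by
  classical
  have h := (measurePreserving_piEquivPiSubtypeProd μ (· ∈ S)).map_eq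
  convert! h

theorem map_restrict_pi {V : Type*} [Fintype V] {E : V → Type*}
    [∀ i, MeasurableSpace (E i)] (μ : ∀ i, Measure (E i)) [∀ i, IsProbabilityMeasure (μ i)]
    (S : Set V) [Fintype S] :
    (Measure.pi μ).map (fun x (i : S) => x i) = Measure.pi fun i : S => μ i := by
  classical
  have h := congrArg Measure.fst (map_restrict_prod_restrict_compl_pi μ S)
  rw [Measure.fst_map_prodMk (by fun_prop), Measure.fst_prod] at h
  exact h

theorem pi_prod_pi_map_mul_add {V : Type*} [Fintype V] (α : V → ℝ) (v w : V → ℝ≥0) :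
    ((Measure.pi fun j => complexNormal (v j)).prod (Measure.pi fun j => complexNormal (w j))).map
      (fun p j => (α j : ℂ) * p.1 j + p.2 j) =
      Measure.pi fun j => complexNormal ((α j ^ 2).toNNReal * v j + w j) := by
  rw [← (measurePreserving_arrowProdEquivProdArrow ℂ ℂ V (fun j => complexNormal (v j))
    (fun j => complexNormal (w j))).map_eq, Measure.map_map (by fun_prop)
    (MeasurableEquiv.measurable _)]
  have hp : ∀ j, IsProbabilityMeasure (((complexNormal (v j)).prod (complexNormal (w j))).map
      fun p => (α j : ℂ) * p.1 + p.2) := fun j => Measure.isProbabilityMeasure_map (by fun_prop)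
  have h := Measure.pi_map_pi (μ := fun j => (complexNormal (v j)).prod (complexNormal (w j)))
    (f := fun j p => (α j : ℂ) * p.1 + p.2) fun j => by fun_prop
  simp_rw [complexNormal_prod_map_mul_add] at h
  exact h

namespace GaussianRelayNetwork

variable {V : Type*} (G : GaussianRelayNetwork V)

open Classical in
/-- The effective gain from `i` to `j`, zero if there is no edge. The receiver indexes the rows. -/
noncomputable def edgeGain (j i : V) : ℂ := if G.graph.Adj i j then G.gain i j else 0

/-- The transfer matrix across a cut, from `Ω` to its complement. -/
noncomputable def cutMatrix (Ω : Set V) : Matrix ↥Ωᶜ ↥Ω ℂ := fun j i => G.edgeGain j i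

theorem PowerConstraint.integrable {p : Measure (V → ℂ)} (hp : PowerConstraint p) (i : V) :
    Integrable (fun x => ‖x i‖ ^ 2) p ∧ ∫ x, ‖x i‖ ^ 2 ∂p ≤ 1 := by
  have h : ∀ x : V → ℂ, ENNReal.ofReal (‖x i‖ ^ 2) = ‖x i‖ₑ ^ 2 := fun x => by
    rw [ENNReal.ofReal_pow (norm_nonneg _), ofReal_norm]
  have hm : Measurable fun x : V → ℂ => ‖x i‖ ^ 2 := by fun_prop
  have hle : ∫⁻ x, ENNReal.ofReal (‖x i‖ ^ 2) ∂p ≤ 1 := by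
    simp_rw [h]
    exact hp i
  refine ⟨⟨hm.aestronglyMeasurable, ?_⟩, ?_⟩
  · rw [hasFiniteIntegral_iff_ofReal (ae_of_all _ fun x => by positivity)]
    exact hle.trans_lt ENNReal.one_lt_top
  · rw [integral_eq_lintegral_of_nonneg_ae (ae_of_all _ fun x => by positivity)
      hm.aestronglyMeasurable]
    exact ENNReal.toReal_mono ENNReal.one_ne_top hle

variable [Fintype V]

theorem received_eq (x z : V → ℂ) (j : V) :
    G.received x z j = ∑ i, G.edgeGain j i * x i + z j := by
  classical
  simp only [received, edgeGain, Finset.sum_filter, ite_mul, zero_mul]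

/-- The energy of the gains into `j`. -/
noncomputable def gainEnergy (j : V) : ℝ := ∑ i, ‖G.edgeGain j i‖ ^ 2

theorem gainEnergy_nonneg (j : V) : 0 ≤ G.gainEnergy j := by
  unfold gainEnergy
  positivity

theorem receivedVariance_eq (j : V) : G.receivedVariance j = G.gainEnergy j + 1 := by
  have h1 := memLp_sum_mul_pi_complexNormal (fun _ : V => 1) (G.edgeGain j)
  have h2 := memLp_eval_pi_complexNormal (fun _ : V => 1) j
  have h3 := integral_norm_add_sq_prod h1 h2 (integral_eval_pi_complexNormal (fun _ : V => 1) j)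
  rw [integral_norm_sq_sum_mul_pi_complexNormal, integral_norm_sq_eval_pi_complexNormal] at h3
  simp_rw [receivedVariance, received_eq, channelLaw, iidInput, h3, gainEnergy]
  simp

theorem quantCoeff_eq (j : V) : G.quantCoeff j = G.gainEnergy j / (G.gainEnergy j + 1) := by
  rw [quantCoeff, receivedVariance_eq, add_sub_cancel_right]

theorem quantCoeff_nonneg (j : V) : 0 ≤ G.quantCoeff j := by
  rw [quantCoeff_eq]
  have := G.gainEnergy_nonneg j
  positivity

theorem quantNoiseVar_eq (j : V) : G.quantNoiseVar j = (G.quantCoeff j).toNNReal := by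
  rw [quantNoiseVar, receivedVariance_eq, quantCoeff_eq]
  have := G.gainEnergy_nonneg j
  congr 1
  field_simp
  ring

/-- The variance of the total noise `α_j Z_j + N_j` in the quantized signal. -/
noncomputable def totalNoiseVar (j : V) : ℝ≥0 :=
  (G.quantCoeff j ^ 2).toNNReal * 1 + G.quantNoiseVar j

theorem coe_totalNoiseVar (j : V) :
    (G.totalNoiseVar j : ℝ) = G.quantCoeff j ^ 2 + G.quantCoeff j := by
  rw [totalNoiseVar, quantNoiseVar_eq, NNReal.coe_add, NNReal.coe_mul,
    Real.coe_toNNReal _ (sq_nonneg _), Real.coe_toNNReal _ (G.quantCoeff_nonneg j)]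
  simp

theorem quantCoeff_eq_zero_of_totalNoiseVar_eq_zero {j : V} (h : G.totalNoiseVar j = 0) :
    G.quantCoeff j = 0 := by
  have h1 := G.coe_totalNoiseVar j
  rw [h, NNReal.coe_zero] at h1
  nlinarith [G.quantCoeff_nonneg j, sq_nonneg (G.quantCoeff j)]

theorem map_quantizedLaw :
    G.quantizedLaw.map (fun ω => (ω.1.1, fun j => (G.quantCoeff j : ℂ) * ω.1.2 j + ω.2 j)) =
      (iidInput V).prod (Measure.pi fun j => complexNormal (G.totalNoiseVar j)) := by
  have h1 := (measurePreserving_prodAssoc (iidInput V) (Measure.pi fun _ : V => complexNormal 1)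
    (Measure.pi fun j => complexNormal (G.quantNoiseVar j))).map_eq
  have h2 := pi_prod_pi_map_mul_add G.quantCoeff (fun _ : V => 1) G.quantNoiseVar
  change _ = (iidInput V).prod (Measure.pi fun j =>
    complexNormal ((G.quantCoeff j ^ 2).toNNReal * 1 + G.quantNoiseVar j))
  rw [← h2, ← Measure.map_id (μ := iidInput V), Measure.map_prod_map _ _ (by fun_prop)
    (by fun_prop), ← h1, Measure.map_map (by fun_prop)
    (MeasurableEquiv.measurable _)]
  rfl

theorem sum_edgeGain_mul (Ω : Set V) [Fintype Ω] [Fintype ↥Ωᶜ] (x : V → ℂ) (j : V) :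
    ∑ i, G.edgeGain j i * x i =
      ∑ i : ↥Ωᶜ, G.edgeGain j i * x i + ∑ i : Ω, G.edgeGain j i * x i := by
  classical
  rw [add_comm, ← Fintype.sum_subtype_add_sum_subtype (· ∈ Ω)]
  congr!

theorem powerConstraint_iidInput : PowerConstraint (iidInput V) := by
  intro i
  have h : ∀ x : V → ℂ, ENNReal.ofReal (‖x i‖ ^ 2) = ‖x i‖ₑ ^ 2 := fun x => by
    rw [ENNReal.ofReal_pow (norm_nonneg _), ofReal_norm]
  simp_rw [← h]
  rw [iidInput, ← ofReal_integral_eq_lintegral_ofReal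
    (memLp_eval_pi_complexNormal (fun _ : V => 1) i).integrable_norm_pow'
    (ae_of_all _ fun x => by positivity)]
  have h1 := integral_norm_sq_eval_pi_complexNormal (fun _ : V => 1) i
  simp only [NNReal.coe_one] at h1
  simp [h1]

end GaussianRelayNetwork

/-! ### Information across a cut -/

namespace GaussianRelayNetwork

variable {V : Type*} [Fintype V] (G : GaussianRelayNetwork V) (Ω : Set V)
  {T : Type*} [MeasurableSpace T] {μ : Measure T}
  [IsProbabilityMeasure μ] {X Y W : T → V → ℂ} [Fintype ↥Ωᶜ]

/-- If the inputs `X` have law `p` and the noises `W` are Gaussian and independent of them, the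
noises on the receiving side of a cut are Gaussian and independent of the inputs on both sides. -/
theorem noise_restrict_law {p : Measure (V → ℂ)} [IsProbabilityMeasure p] {v : V → ℝ≥0}
    (hX : Measurable X) (hW : Measurable W)
    (hlaw : μ.map (fun t => (X t, W t)) = p.prod (Measure.pi fun j => complexNormal (v j))) :
    μ.map X = p ∧ (μ.map fun t (j : ↥Ωᶜ) => W t j) =
        Measure.pi (fun j : ↥Ωᶜ => complexNormal (v j)) ∧
      IndepFun (fun t => ((fun i : ↥Ωᶜ => X t i), (fun i : Ω => X t i)))
        (fun t (j : ↥Ωᶜ) => W t j) μ := by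
  have hX' : μ.map X = p := by
    have := congrArg Measure.fst hlaw
    rwa [Measure.fst_map_prodMk hW, Measure.fst_prod] at this
  have hW' : μ.map W = Measure.pi fun j => complexNormal (v j) := by
    have := congrArg Measure.snd hlaw
    rwa [Measure.snd_map_prodMk hX, Measure.snd_prod] at this
  have hind : IndepFun X W μ := by
    rw [indepFun_iff_map_prod_eq_prod_map_map hX.aemeasurable hW.aemeasurable, hlaw, hX', hW']
  refine ⟨hX', ?_, ?_⟩
  · rw [← map_restrict_pi (fun j => complexNormal (v j)) Ωᶜ, ← hW',
      Measure.map_map (by fun_prop) hW]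
    rfl
  · exact hind.comp (φ := fun x : V → ℂ => ((fun i : ↥Ωᶜ => x i), (fun i : Ω => x i)))
      (ψ := fun w (j : ↥Ωᶜ) => w j) (by fun_prop) (by fun_prop)

variable [Fintype Ω]

/-- The upper bound across a cut for outputs `Y j = β j ∑ i, h j i X i + W j`. It covers the
received signals (`β = 1`) and the quantized signals (`β = α`). -/
theorem condMutualInfo_cut_le {p : Measure (V → ℂ)} [IsProbabilityMeasure p]
    (hp : PowerConstraint p) {v : V → ℝ≥0} {β : V → ℝ} (hβ : ∀ j, v j = 0 → β j = 0)
    (hX : Measurable X) (hW : Measurable W)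
    (hlaw : μ.map (fun t => (X t, W t)) = p.prod (Measure.pi fun j => complexNormal (v j)))
    (hY : ∀ t j, Y t j = β j * ∑ i, G.edgeGain j i * X t i + W t j) :
    condMutualInfo (fun t (j : ↥Ωᶜ) => Y t j) (fun t (i : Ω) => X t i)
        (fun t (i : ↥Ωᶜ) => X t i) μ ≤
      ENNReal.ofReal (Fintype.card Ω - Real.log (gaussianLaplace
        (Matrix.of fun (j : ↥Ωᶜ) i => (β j : ℂ) * G.cutMatrix Ω j i).mulVecLin
          fun j => v j).toReal) / ENNReal.ofReal (Real.log 2) := by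
  obtain ⟨hX', hW', hind⟩ := noise_restrict_law Ω hX hW hlaw
  have hi : ∀ i, Integrable (fun t => ‖X t i‖ ^ 2) μ ∧ ∫ t, ‖X t i‖ ^ 2 ∂μ ≤ 1 := by
    intro i
    obtain ⟨h1, h2⟩ := PowerConstraint.integrable hp i
    rw [← hX'] at h1 h2
    rw [integral_map hX.aemeasurable h1.1] at h2
    exact ⟨(integrable_map_measure h1.1 hX.aemeasurable).1 h1, h2⟩
  refine (condMutualInfo_le_of_gaussian_noise (Matrix.of fun (j : ↥Ωᶜ) i =>
    (β j : ℂ) * G.cutMatrix Ω j i).mulVecLin (fun j : ↥Ωᶜ => v j) ?_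
    (s := fun (c : ↥Ωᶜ → ℂ) (j : ↥Ωᶜ) => β j * ∑ i : ↥Ωᶜ, G.edgeGain j i * c i)
    (by fun_prop) (by fun_prop) (by fun_prop)
    (Z := fun t (j : ↥Ωᶜ) => W t j) (by fun_prop) ?_ hW' hind
    (integrable_finsetSum _ fun i _ => (hi i).1)).trans ?_
  · intro x j hj
    simp [Matrix.mulVec, dotProduct, hβ j hj]
  · intro t
    ext j
    rw [hY, G.sum_edgeGain_mul Ω]
    simp [Matrix.mulVec, dotProduct, cutMatrix, mul_add, Finset.mul_sum, mul_assoc]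
  · refine ENNReal.div_le_div_right (ENNReal.ofReal_le_ofReal (sub_le_sub_right ?_ _)) _
    rw [integral_finsetSum _ fun (i : Ω) _ => (hi i).1]
    refine (Finset.sum_le_sum fun (i : Ω) _ => (hi i).2).trans ?_
    simp

theorem cutInfo_le {p : Measure (V → ℂ)} [IsProbabilityMeasure p] (hp : PowerConstraint p) :
    G.cutInfo p Ω ≤ ENNReal.ofReal (Fintype.card Ω -
      Real.log (gaussianLaplace (G.cutMatrix Ω).mulVecLin 1).toReal) /
        ENNReal.ofReal (Real.log 2) := by
  have h := G.condMutualInfo_cut_le Ω (μ := channelLaw p) (X := Prod.fst) (W := Prod.snd)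
    (Y := fun ω => G.received ω.1 ω.2) hp (v := fun _ => 1) (β := fun _ => 1) (by simp)
    measurable_fst measurable_snd Measure.map_id (by simp [received_eq])
  have hM : (Matrix.of fun (j : ↥Ωᶜ) i => ((1 : ℝ) : ℂ) * G.cutMatrix Ω j i) = G.cutMatrix Ω := by
    ext
    simp
  rw [hM] at h
  exact h

theorem quantized_eq (x z n : V → ℂ) (j : V) : G.quantized x z n j =
    G.quantCoeff j * ∑ i, G.edgeGain j i * x i + ((G.quantCoeff j : ℂ) * z j + n j) := by
  rw [quantized, received_eq]
  ring

theorem quantizedCutInfo_ne_top : G.quantizedCutInfo Ω ≠ ∞ := by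
  have h := G.condMutualInfo_cut_le Ω (μ := G.quantizedLaw) (X := fun ω => ω.1.1)
    (W := fun ω j => (G.quantCoeff j : ℂ) * ω.1.2 j + ω.2 j)
    (Y := fun ω => G.quantized ω.1.1 ω.1.2 ω.2) powerConstraint_iidInput
    (fun j => G.quantCoeff_eq_zero_of_totalNoiseVar_eq_zero) (by fun_prop) (by fun_prop)
    G.map_quantizedLaw (fun t j => G.quantized_eq _ _ _ j)
  refine (h.trans_lt (ENNReal.div_lt_top ENNReal.ofReal_ne_top ?_)).ne
  simpa using Real.log_pos one_lt_two

theorem le_quantizedCutInfo :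
    ENNReal.ofReal (-Real.log (gaussianLaplace (G.cutMatrix Ω).mulVecLin 1).toReal -
      Fintype.card ↥Ωᶜ) / ENNReal.ofReal (Real.log 2) ≤ G.quantizedCutInfo Ω := by
  obtain ⟨hX, hW, hind⟩ := noise_restrict_law Ω (μ := G.quantizedLaw) (X := fun ω => ω.1.1)
    (W := fun ω j => (G.quantCoeff j : ℂ) * ω.1.2 j + ω.2 j) (by fun_prop) (by fun_prop)
    G.map_quantizedLaw
  have hcut : G.quantizedLaw.map (fun ω => ((fun i : Ω => ω.1.1 i), (fun i : ↥Ωᶜ => ω.1.1 i))) =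
      (iidInput Ω).prod (iidInput ↥Ωᶜ) := by
    have h1 := map_restrict_prod_restrict_compl_pi (fun _ : V => complexNormal 1) Ω
    change (iidInput V).map _ = _ at h1
    rw [← hX, Measure.map_map (by fun_prop) (by fun_prop)] at h1
    exact h1
  have hB : G.quantizedLaw.map (fun ω (i : Ω) => ω.1.1 i) = iidInput Ω := by
    have := congrArg Measure.fst hcut
    rwa [Measure.fst_map_prodMk (by fun_prop), Measure.fst_prod] at this
  have hC : G.quantizedLaw.map (fun ω (i : ↥Ωᶜ) => ω.1.1 i) = iidInput ↥Ωᶜ := by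
    have := congrArg Measure.snd hcut
    rwa [Measure.snd_map_prodMk (by fun_prop), Measure.snd_prod] at this
  have hBC : IndepFun (fun ω (i : Ω) => ω.1.1 i) (fun ω (i : ↥Ωᶜ) => ω.1.1 i) G.quantizedLaw := by
    rw [indepFun_iff_map_prod_eq_prod_map_map (by fun_prop) (by fun_prop), hcut, hB, hC]
  have hα : ∀ j, (G.totalNoiseVar j : ℝ) * (G.gainEnergy j / (2 * G.gainEnergy j + 1)) =
      G.quantCoeff j ^ 2 := by
    intro j
    rw [coe_totalNoiseVar, quantCoeff_eq]
    have := G.gainEnergy_nonneg j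
    field_simp
    ring
  refine le_condMutualInfo_of_gaussian_noise (G.cutMatrix Ω) (fun j : ↥Ωᶜ => G.totalNoiseVar j)
    (fun j : ↥Ωᶜ => G.gainEnergy j) _ ?_ (fun j => rfl) ?_
    (s := fun (c : ↥Ωᶜ → ℂ) (j : ↥Ωᶜ) => G.quantCoeff j * ∑ i : ↥Ωᶜ, G.edgeGain j i * c i)
    (by fun_prop) (by fun_prop) (by fun_prop)
    (Z := fun ω (j : ↥Ωᶜ) => (G.quantCoeff j : ℂ) * ω.1.2 j + ω.2 j) (by fun_prop) ?_ hB
    hBC.symm hW hind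
  · intro j
    classical
    rw [gainEnergy, ← Fintype.sum_subtype_add_sum_subtype (· ∈ Ω)]
    refine le_trans (le_of_eq ?_) (le_add_of_nonneg_right (by positivity))
    simp only [cutMatrix]
    congr!
  · intro j hj
    have h0 := G.quantCoeff_eq_zero_of_totalNoiseVar_eq_zero hj
    have h1 := G.gainEnergy_nonneg j
    rw [quantCoeff_eq, div_eq_zero_iff] at h0
    rcases h0 with h0 | h0
    · simp [h0]
    · linarith
  · intro ω j
    rw [hα, Real.sqrt_sq (G.quantCoeff_nonneg j), quantized_eq, G.sum_edgeGain_mul Ω, mul_add]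
    rfl

theorem cutSetBound_le_quantizedCutInfo_add (hΩ : Ω ∈ G.cuts) :
    G.cutSetBound ≤ G.quantizedCutInfo Ω +
      ENNReal.ofReal (Fintype.card V) / ENNReal.ofReal (Real.log 2) := by
  refine iSup₂_le fun p hp => (iInf₂_le Ω hΩ).trans ((G.cutInfo_le Ω hp).trans ?_)
  have hcard : (Fintype.card Ω : ℝ) + Fintype.card ↥Ωᶜ = Fintype.card V := by
    classical
    have := Fintype.card_congr (Equiv.Set.sumCompl Ω)
    rw [Fintype.card_sum] at this
    exact_mod_cast this
  refine le_trans ?_ (add_le_add_left (G.le_quantizedCutInfo Ω) _)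
  rw [← ENNReal.add_div]
  refine ENNReal.div_le_div_right ((ENNReal.ofReal_le_ofReal ?_).trans ENNReal.ofReal_add_le) _
  linarith

end GaussianRelayNetwork

theorem mainTheorem4 {V : Type*} [Fintype V] (G : GaussianRelayNetwork V) :
    G.cutSetBound ≠ ∞ ∧ G.quantizedMinCut ≠ ∞ ∧
      G.cutSetBound.toReal - G.quantizedMinCut.toReal < 2 * (Fintype.card V : ℝ) := by
  classical
  have hlog : 0 < Real.log 2 := Real.log_pos one_lt_two
  set c : ℝ≥0∞ := ENNReal.ofReal (Fintype.card V) / ENNReal.ofReal (Real.log 2) with hc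
  have hct : c ≠ ∞ := (ENNReal.div_lt_top ENNReal.ofReal_ne_top (by simpa using hlog)).ne
  have hle : G.cutSetBound ≤ G.quantizedMinCut + c := by
    rw [← tsub_le_iff_right]
    exact le_iInf₂ fun Ω hΩ => tsub_le_iff_right.2 (G.cutSetBound_le_quantizedCutInfo_add Ω hΩ)
  -- a single cut makes the minimum finite
  have hmem : {G.source} ∈ G.cuts := ⟨rfl, fun h => G.source_ne_dest h.symm⟩
  have hq : G.quantizedMinCut ≠ ∞ :=
    ((iInf₂_le _ hmem).trans_lt (G.quantizedCutInfo_ne_top {G.source}).lt_top).ne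
  have hsum : G.quantizedMinCut + c ≠ ∞ := ENNReal.add_ne_top.2 ⟨hq, hct⟩
  refine ⟨ne_top_of_le_ne_top hsum hle, hq, ?_⟩
  have h1 := ENNReal.toReal_mono hsum hle
  rw [ENNReal.toReal_add hq hct, hc, ENNReal.toReal_div, ENNReal.toReal_ofReal (by positivity),
    ENNReal.toReal_ofReal hlog.le] at h1
  have hcard : (0 : ℝ) < Fintype.card V := by
    exact_mod_cast Fintype.card_pos_iff.2 ⟨G.source⟩
  have h2 : (Fintype.card V : ℝ) / Real.log 2 < 2 * Fintype.card V := by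
    rw [div_lt_iff₀ hlog]
    nlinarith [Real.log_two_gt_d9]
  linarith
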